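/- **Conventions.** A *computable metric space* is a complete metric space $(X,d)$ with a dense sequence $(x_i)_{i\in\mathbb N}$ of *basic points* such that the reals $d(x_i,x_j)$ are computable uniformly in $(i,j)$. On $\mathbb N$ all points and on $\mathbb R$ all rationals are basic; a product carries the maximum metric and the pairs of basic points. A *Cauchy name* for $y$ is $h\in\mathbb N^{\mathbb N}$ with $d(x_{h(j)},x_{h(i)})\le 2^{-i}$ for all $j\ge i$ and $y=\lim_i x_{h(i)}$. A map $f$ is *computable* if some partial computable map on $\mathbb N^{\mathbb N}$ sends every Cauchy name of every point $x$ to a Cauchy name of $f(x)$. A set is *effectively open* if it is the union of a computable set of open balls with basic centres and positive rational radii (for a standard enumeration of these balls), and *effectively closed* if its complement is effectively open. A function $t$ with values in $[0,\infty]$ is *lower semicomputable* if $t=\sup_n g(n,\cdot)$ for a computable real-valued function $g(n,x)$. For a computable metric space $X$, the *basic functions* are the functions generated from the constant $1$ and the bump functions $$y\mapsto\max\Bigl(0,\min\Bigl(1,\frac{s-d(x_i,y)}{s-r}\Bigr)\Bigr)\qquad(r<s\text{ positive rationals})$$ by $\max$, $\min$ and rational linear combinations; let $(f_i)_{i\in\mathbb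 N}$ be a natural effective enumeration of them. The space $\mathcal M(X)$ of finite Borel measures on $X$ carries the metric $$d(\mu,\nu)=\sum_i 2^{-i}\Bigl(1-\exp\Bigl(-\Bigl|\int f_i\,d\mu-\int f_i\,d\nu\Bigr|\Bigr)\Bigr),$$ with the measures $q_1\delta_{z_1}+\dots+q_n\delta_{z_n}$ ($n\ge1$, $q_j$ positive rational, $z_j$ basic) as basic points; Cauchy names, computable maps, effectively open sets and lower semicomputable functions are defined for it, and for products with it, as above. **Tests.** Let $A$ and $X$ be computable metric spaces. A *uniform Schnorr integral test* is a lower semicomputable $t\colon A\times\mathcal M(X)\times X\to[0,\infty]$ such that $\int t(a,\mu,x)\,d\mu(x)<\infty$ for all $a\in A$, $\mu\in\mathcal M(X)$, and such that $(a,\mu)\mapsto\int t(a,\mu,x)\,d\mu(x)$ is a computable map $A\times\mathcal M(X)\to\mathbb R$. A point $x\in X$ is *uniformly Schnorr $\mu$-random relative to the oracle $a$*, written $x\in\mathsf{SR}^a_\mu$, if $t(a,\mu,x)<\infty$ for every uniform Schnorr integral test $t$. A *uniform Kurtz test* is an effectively closed set $P\subseteq A\times\mathcal M(X)\times X$ such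 that $\mu\{x:(a,\mu,x)\in P\}=0$ for all $a\in A$, $\mu\in\mathcal M(X)$. A point $x\in X$ is *uniformly Kurtz $\mu$-random relative to the oracle $a$*, written $x\in\mathsf{KR}^a_\mu$, if $(a,\mu,x)\notin P$ for every uniform Kurtz test $P$. **Proposition.** Let $A$ and $X$ be computable metric spaces, $a\in A$, $\mu\in\mathcal M(X)$ (both possibly noncomputable) and $x\in X$. If $x\in\mathsf{SR}^a_\mu$, then $x\in\mathsf{KR}^a_\mu$. -/

import Mathlib

open MeasureTheory Filter Topology

noncomputable section

/-! ## Codes for rationals and basic points -/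

/-- The standard surjection from codes to positive rationals. -/
def posRat (n : ℕ) : ℚ≥0 := ((n.unpair.1 : ℚ≥0) + 1) / ((n.unpair.2 : ℚ≥0) + 1)

/-- The standard surjection from codes to rationals, `⟨⟨p, q⟩, r⟩ ↦ (p - q) / (r + 1)`. -/
def ratOfCode (n : ℕ) : ℚ :=
  ((n.unpair.1.unpair.1 : ℚ) - n.unpair.1.unpair.2) / ((n.unpair.2 : ℚ) + 1)

/-- A distinguished sequence of points. -/
class BasicPoints (X : Type*) where
  basicPt : ℕ → X


instance : BasicPoints ℕ := ⟨id⟩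

instance : BasicPoints ℝ := ⟨fun n => (ratOfCode n : ℝ)⟩

/-- Basic points of a product: pairs of basic points (the metric is the maximum metric). -/
instance {X Y : Type*} [BasicPoints X] [BasicPoints Y] : BasicPoints (X × Y) :=
  ⟨fun n => (BasicPoints.basicPt n.unpair.1, BasicPoints.basicPt n.unpair.2)⟩

/-- `h` is a Cauchy name for `y`. -/
def IsCauchyName {X : Type*} [PseudoMetricSpace X] [BasicPoints X] (h : ℕ → ℕ) (y : X) : Prop :=
  (∀ i j : ℕ, i ≤ j →
    dist (BasicPoints.basicPt (h j) : X) (BasicPoints.basicPt (h i)) ≤ (2 : ℝ)⁻¹ ^ i) ∧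
  Tendsto (fun i => (BasicPoints.basicPt (h i) : X)) atTop (𝓝 y)

/-- A computable metric space: a complete metric space with a dense sequence of basic points
whose mutual distances are real numbers computable uniformly in the indices, that is, with
rational Cauchy names produced by one computable function. -/
class ComputableMetricSpace (X : Type*) extends MetricSpace X, BasicPoints X where
  complete : CompleteSpace X
  dense : DenseRange (BasicPoints.basicPt : ℕ → X)
  computable_dist : ∃ g : ℕ × ℕ → ℕ → ℕ, Computable₂ g ∧
    ∀ i j : ℕ, IsCauchyName (g (i, j))
      (dist (BasicPoints.basicPt i : X) (BasicPoints.basicPt j))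

/-! ## Computable maps, effectively open sets, lower semicomputable functions -/

/-- The partial map on Baire space given by `φ`: to find the `n`-th value of the output
on input `h`, feed longer and longer initial segments of `h` to `φ` until it answers. -/
def functional (φ : List ℕ × ℕ → Option ℕ) (h : ℕ → ℕ) (n : ℕ) : Part ℕ :=
  Nat.rfindOpt fun k => φ ((List.range k).map h, n)

/-- `f` is computable: a partial computable map on Baire space sends every Cauchy name of
every point `x` to a Cauchy name of `f x`. -/
def ComputableMap {X Y : Type*} [PseudoMetricSpace X] [BasicPoints X]
    [PseudoMetricSpace Y] [BasicPoints Y] (f : X → Y) : Prop :=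
  ∃ φ : List ℕ × ℕ → Option ℕ, Computable φ ∧
    ∀ (x : X) (h : ℕ → ℕ), IsCauchyName h x →
      ∃ h' : ℕ → ℕ, (∀ n, h' n ∈ functional φ h n) ∧ IsCauchyName h' (f x)

/-- The `n`-th basic open ball. -/
def basicBall (X : Type*) [PseudoMetricSpace X] [BasicPoints X] (n : ℕ) : Set X :=
  Metric.ball (BasicPoints.basicPt n.unpair.1) (posRat n.unpair.2 : ℝ)

/-- Effectively open: the union of a computable set of basic open balls. -/
def EffectivelyOpen {X : Type*} [PseudoMetricSpace X] [BasicPoints X] (U : Set X) : Prop :=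
  ∃ I : Set ℕ, ComputablePred (fun n => n ∈ I) ∧ U = ⋃ n ∈ I, basicBall X n

def EffectivelyClosed {X : Type*} [PseudoMetricSpace X] [BasicPoints X] (C : Set X) : Prop :=
  EffectivelyOpen Cᶜ

/-- A function with values in `[0, ∞]` is lower semicomputable if it is the pointwise supremum
of a computable sequence of computable real functions. -/
def LowerSemicomputable {X : Type*} [PseudoMetricSpace X] [BasicPoints X]
    (t : X → ENNReal) : Prop :=
  ∃ g : ℕ × X → ℝ, ComputableMap g ∧
    ∀ x, ((t x : ENNReal) : EReal) = ⨆ n : ℕ, ((g (n, x) : ℝ) : EReal)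

/-! ## Basic functions -/

/-- Expressions for the basic functions: the constant one and the basic bump functions, closed
under maxima, minima and rational linear combinations. -/
inductive BasicExpr : Type
  | one : BasicExpr
  | bump (i r s : ℕ) : BasicExpr
  | sup (e f : BasicExpr) : BasicExpr
  | inf (e f : BasicExpr) : BasicExpr
  | comb (p q : ℕ) (e f : BasicExpr) : BasicExpr

/-- The bump function which is `1` up to distance `r` from `c`, is `0` from distance `s` on,
and is linear in the distance in between. -/
def bumpFun {X : Type*} [PseudoMetricSpace X] (c : X) (r s : ℝ) (y : X) : ℝ :=
  max 0 (min 1 ((s - dist c y) / (s - r)))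

theorem bumpFun_eq {X : Type*} [PseudoMetricSpace X] (c : X) (r s : ℝ) (hrs : r < s) (y : X) :
    bumpFun c r s y =
      if dist c y ≤ r then 1 else if dist c y ≤ s then (s - dist c y) / (s - r) else 0 := by
  have hpos : 0 < s - r := sub_pos.2 hrs
  unfold bumpFun
  split_ifs with h1 h2
  · rw [min_eq_left ((one_le_div hpos).2 (by linarith))]; simp
  · rw [min_eq_right ((div_le_one hpos).2 (by linarith)),
      max_eq_right (div_nonneg (by linarith) hpos.le)]
  · exact max_eq_left ((min_le_right _ _).trans
      (div_nonpos_of_nonpos_of_nonneg (by linarith) hpos.le))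

/-- The function denoted by an expression. In a bump, the radii are `r` and `r + s`, for
arbitrary positive rationals `r` and `s`. -/
def BasicExpr.eval {X : Type*} [PseudoMetricSpace X] [BasicPoints X] : BasicExpr → X → ℝ
  | .one, _ => 1
  | .bump i r s, y => bumpFun (BasicPoints.basicPt i) (posRat r : ℝ) (posRat r + posRat s : ℝ) y
  | .sup e f, y => max (e.eval y) (f.eval y)
  | .inf e f, y => min (e.eval y) (f.eval y)
  | .comb p q e f, y => (ratOfCode p : ℝ) * e.eval y + (ratOfCode q : ℝ) * f.eval y

/-- An effective enumeration of all expressions. -/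
def BasicExpr.ofNat : ℕ → BasicExpr
  | 0 => .one
  | n + 1 =>
    have h0 : n / 4 < n + 1 := by omega
    have h1 : (n / 4).unpair.1 < n + 1 := (Nat.unpair_left_le _).trans_lt h0
    have h2 : (n / 4).unpair.2 < n + 1 := (Nat.unpair_right_le _).trans_lt h0
    have h3 : (n / 4).unpair.2.unpair.1 < n + 1 := (Nat.unpair_left_le _).trans_lt h2
    have h4 : (n / 4).unpair.2.unpair.2 < n + 1 := (Nat.unpair_right_le _).trans_lt h2
    match n % 4 with
    | 0 => .bump (n / 4).unpair.1 (n / 4).unpair.2.unpair.1 (n / 4).unpair.2.unpair.2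
    | 1 => .sup (ofNat (n / 4).unpair.1) (ofNat (n / 4).unpair.2)
    | 2 => .inf (ofNat (n / 4).unpair.1) (ofNat (n / 4).unpair.2)
    | _ => .comb (n / 4).unpair.1.unpair.1 (n / 4).unpair.1.unpair.2
        (ofNat (n / 4).unpair.2.unpair.1) (ofNat (n / 4).unpair.2.unpair.2)

theorem BasicExpr.ofNat_surjective : Function.Surjective BasicExpr.ofNat := by
  intro e
  induction e with
  | one => exact ⟨0, by rw [BasicExpr.ofNat]⟩
  | bump i r s =>
    refine ⟨4 * Nat.pair i (Nat.pair r s) + 1, ?_⟩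
    rw [BasicExpr.ofNat]
    have hm : (4 * Nat.pair i (Nat.pair r s)) % 4 = 0 := by omega
    have hd : (4 * Nat.pair i (Nat.pair r s)) / 4 = Nat.pair i (Nat.pair r s) := by omega
    rw [hm, hd]; simp
  | sup e f he hf =>
    obtain ⟨a, rfl⟩ := he
    obtain ⟨b, rfl⟩ := hf
    refine ⟨4 * Nat.pair a b + 1 + 1, ?_⟩
    rw [BasicExpr.ofNat]
    have hm : (4 * Nat.pair a b + 1) % 4 = 1 := by omega
    have hd : (4 * Nat.pair a b + 1) / 4 = Nat.pair a b := by omega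
    rw [hm, hd]; simp
  | inf e f he hf =>
    obtain ⟨a, rfl⟩ := he
    obtain ⟨b, rfl⟩ := hf
    refine ⟨4 * Nat.pair a b + 2 + 1, ?_⟩
    rw [BasicExpr.ofNat]
    have hm : (4 * Nat.pair a b + 2) % 4 = 2 := by omega
    have hd : (4 * Nat.pair a b + 2) / 4 = Nat.pair a b := by omega
    rw [hm, hd]; simp
  | comb p q e f he hf =>
    obtain ⟨a, rfl⟩ := he
    obtain ⟨b, rfl⟩ := hf
    refine ⟨4 * Nat.pair (Nat.pair p q) (Nat.pair a b) + 3 + 1, ?_⟩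
    rw [BasicExpr.ofNat]
    have hm : (4 * Nat.pair (Nat.pair p q) (Nat.pair a b) + 3) % 4 = 3 := by omega
    have hd : (4 * Nat.pair (Nat.pair p q) (Nat.pair a b) + 3) / 4
        = Nat.pair (Nat.pair p q) (Nat.pair a b) := by omega
    rw [hm, hd]; simp

theorem BasicExpr.continuous_eval {X : Type*} [PseudoMetricSpace X] [BasicPoints X]
    (e : BasicExpr) : Continuous (e.eval : X → ℝ) := by
  induction e with
  | one => exact continuous_const
  | bump i r s =>
    change Continuous fun y => bumpFun _ _ _ y
    unfold bumpFun
    fun_prop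
  | sup e f he hf => exact he.max hf
  | inf e f he hf => exact he.min hf
  | comb p q e f he hf => exact (continuous_const.mul he).add (continuous_const.mul hf)

/-! ## The space of finite measures -/

/-- The finite Borel measures on `X`; a copy of `FiniteMeasure X`, carrying the metric below. -/
def FinMeas (X : Type*) [MeasurableSpace X] : Type _ := FiniteMeasure X

def FinMeas.toMeasure {X : Type*} [MeasurableSpace X] (μ : FinMeas X) : Measure X :=
  FiniteMeasure.toMeasure μ

instance {X : Type*} [MeasurableSpace X] (μ : FinMeas X) : IsFiniteMeasure μ.toMeasure :=
  μ.2

/-- The integral of the `i`-th basic function. -/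
def basicIntegral {X : Type*} [PseudoMetricSpace X] [BasicPoints X] [MeasurableSpace X]
    (i : ℕ) (μ : FinMeas X) : ℝ :=
  ∫ x, (BasicExpr.ofNat i).eval x ∂μ.toMeasure

/-- The distance `∑ᵢ 2⁻ⁱ (1 - exp (-|∫ fᵢ dμ - ∫ fᵢ dν|))`. -/
def measDist {X : Type*} [PseudoMetricSpace X] [BasicPoints X] [MeasurableSpace X]
    (μ ν : FinMeas X) : ℝ :=
  ∑' i : ℕ, (2 : ℝ)⁻¹ ^ i * (1 - Real.exp (-|basicIntegral i μ - basicIntegral i ν|))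

theorem measDist_term_nonneg {X : Type*} [PseudoMetricSpace X] [BasicPoints X]
    [MeasurableSpace X] (μ ν : FinMeas X) (i : ℕ) :
    0 ≤ (2 : ℝ)⁻¹ ^ i * (1 - Real.exp (-|basicIntegral i μ - basicIntegral i ν|)) := by
  refine mul_nonneg (by positivity) (sub_nonneg.2 (Real.exp_le_one_iff.2 ?_))
  exact neg_nonpos.2 (abs_nonneg _)

theorem measDist_summable {X : Type*} [PseudoMetricSpace X] [BasicPoints X]
    [MeasurableSpace X] (μ ν : FinMeas X) :
    Summable fun i : ℕ =>
      (2 : ℝ)⁻¹ ^ i * (1 - Real.exp (-|basicIntegral i μ - basicIntegral i ν|)) := by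
  refine Summable.of_nonneg_of_le (measDist_term_nonneg μ ν) (fun i => ?_)
    (summable_geometric_of_lt_one (r := (2 : ℝ)⁻¹) (by norm_num) (by norm_num))
  refine mul_le_of_le_one_right (by positivity) ?_
  linarith [Real.exp_pos (-|basicIntegral i μ - basicIntegral i ν|)]

theorem one_sub_exp_triangle (u v w : ℝ) :
    1 - Real.exp (-|u - w|) ≤ (1 - Real.exp (-|u - v|)) + (1 - Real.exp (-|v - w|)) := by
  have h1 : Real.exp (-|u - v|) * Real.exp (-|v - w|) ≤ Real.exp (-|u - w|) := by
    rw [← Real.exp_add]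
    exact Real.exp_le_exp.2 (by linarith [abs_sub_le u v w])
  have h2 : Real.exp (-|u - v|) ≤ 1 := Real.exp_le_one_iff.2 (neg_nonpos.2 (abs_nonneg _))
  have h3 : Real.exp (-|v - w|) ≤ 1 := Real.exp_le_one_iff.2 (neg_nonpos.2 (abs_nonneg _))
  nlinarith

theorem basicIntegral_eq_of_measDist_eq_zero {X : Type*} [PseudoMetricSpace X] [BasicPoints X]
    [MeasurableSpace X] (μ ν : FinMeas X) (h : measDist μ ν = 0) (i : ℕ) :
    basicIntegral i μ = basicIntegral i ν := by
  have h1 := (hasSum_zero_iff_of_nonneg (measDist_term_nonneg μ ν)).1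
    (by have h0 := (measDist_summable μ ν).hasSum; rwa [← measDist, h] at h0)
  have h2 := congrFun h1 i
  simp only [Pi.zero_apply, mul_eq_zero, pow_eq_zero_iff', inv_eq_zero, OfNat.ofNat_ne_zero,
    false_and, false_or] at h2
  have h3 : Real.exp (-|basicIntegral i μ - basicIntegral i ν|) = 1 := by linarith
  rw [Real.exp_eq_one_iff, neg_eq_zero, abs_eq_zero, sub_eq_zero] at h3
  exact h3

/-- Sets whose indicator is a pointwise limit of basic functions with values in `[0, 1]`. -/
def BasicLimitSet {X : Type*} [PseudoMetricSpace X] [BasicPoints X] (B : Set X) : Prop :=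
  ∃ e : ℕ → BasicExpr, (∀ n (x : X), 0 ≤ (e n).eval x ∧ (e n).eval x ≤ 1) ∧
    ∀ x : X, Tendsto (fun n => (e n).eval x) atTop (𝓝 (B.indicator (fun _ => (1 : ℝ)) x))

theorem basicLimitSet_ball {X : Type*} [PseudoMetricSpace X] [BasicPoints X] (i : ℕ) (N : ℕ) :
    BasicLimitSet (Metric.ball (BasicPoints.basicPt i : X) ((1 : ℝ) / (N + 1))) := by
  set q : ℕ → ℕ := fun n => N * n + 2 * N + n + 1
  have hq : ∀ n, ((q n : ℝ) + 1) = (N + 1) * (n + 2) := by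
    intro n; simp only [q]; push_cast; ring
  have hr : ∀ n, ((posRat (Nat.pair n (q n)) : ℚ≥0) : ℝ) = (n + 1) / ((N + 1) * (n + 2)) := by
    intro n; rw [← hq]; simp [posRat]
  have hs : ∀ n, ((posRat (Nat.pair 0 (q n)) : ℚ≥0) : ℝ) = 1 / ((N + 1) * (n + 2)) := by
    intro n; rw [← hq]; simp [posRat]
  have hrs : ∀ n : ℕ, ((n : ℝ) + 1) / ((N + 1) * (n + 2)) + 1 / ((N + 1) * (n + 2))
      = 1 / ((N : ℝ) + 1) := by
    intro n; field_simp; ring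
  refine ⟨fun n => .bump i (Nat.pair n (q n)) (Nat.pair 0 (q n)), fun n x => ⟨?_, ?_⟩, ?_⟩
  · exact le_max_left _ _
  · exact max_le zero_le_one (min_le_left _ _)
  · intro x
    have hev : ∀ n, (BasicExpr.bump i (Nat.pair n (q n)) (Nat.pair 0 (q n))).eval x =
        bumpFun (BasicPoints.basicPt i) (((n : ℝ) + 1) / ((N + 1) * (n + 2)))
          (1 / ((N : ℝ) + 1)) x := by
      intro n
      simp only [BasicExpr.eval, hr, hs, hrs]
    have hlt : ∀ n : ℕ, ((n : ℝ) + 1) / ((N + 1) * (n + 2)) < 1 / ((N : ℝ) + 1) := by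
      intro n
      have : 0 < 1 / (((N : ℝ) + 1) * (n + 2)) := by positivity
      linarith [hrs n]
    simp only [hev]
    by_cases hx : dist x (BasicPoints.basicPt i) < 1 / ((N : ℝ) + 1)
    · rw [Set.indicator_of_mem (Metric.mem_ball.2 hx)]
      have hlim : Tendsto (fun n : ℕ => ((n : ℝ) + 1) / ((N + 1) * (n + 2))) atTop
          (𝓝 (1 / ((N : ℝ) + 1))) := by
        have h1 : Tendsto (fun n : ℕ => (1 : ℝ) / ((N : ℝ) + 1)
            - 1 / ((N : ℝ) + 1) * (1 / (((n + 1 : ℕ) : ℝ) + 1))) atTop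
            (𝓝 (1 / ((N : ℝ) + 1) - 1 / ((N : ℝ) + 1) * 0)) :=
          tendsto_const_nhds.sub (tendsto_const_nhds.mul
            ((tendsto_one_div_add_atTop_nhds_zero_nat (𝕜 := ℝ)).comp (tendsto_add_atTop_nat 1)))
        rw [mul_zero, sub_zero] at h1
        refine h1.congr fun n => ?_
        push_cast
        field_simp
        ring
      refine tendsto_const_nhds.congr' ?_
      filter_upwards [hlim.eventually (lt_mem_nhds hx)] with n hn
      rw [bumpFun_eq _ _ _ (hlt n), if_pos]
      rw [dist_comm]
      exact hn.le
    · rw [Set.indicator_of_notMem (fun h => hx (Metric.mem_ball.1 h))]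
      refine tendsto_const_nhds.congr fun n => ?_
      rw [dist_comm] at hx
      refine (max_eq_left ((min_le_right _ _).trans ?_)).symm
      exact div_nonpos_of_nonpos_of_nonneg (by linarith) (sub_pos.2 (hlt n)).le

theorem BasicLimitSet.inter {X : Type*} [PseudoMetricSpace X] [BasicPoints X] {B C : Set X}
    (hB : BasicLimitSet B) (hC : BasicLimitSet C) : BasicLimitSet (B ∩ C) := by
  obtain ⟨e, he, he'⟩ := hB
  obtain ⟨f, hf, hf'⟩ := hC
  refine ⟨fun n => .inf (e n) (f n), fun n x => ⟨le_min (he n x).1 (hf n x).1,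
    (min_le_left _ _).trans (he n x).2⟩, fun x => ?_⟩
  have h := (he' x).min (hf' x)
  have hind : (B ∩ C).indicator (fun _ => (1 : ℝ)) x =
      min (B.indicator (fun _ => (1 : ℝ)) x) (C.indicator (fun _ => (1 : ℝ)) x) := by
    by_cases h1 : x ∈ B <;> by_cases h2 : x ∈ C <;> simp [h1, h2]
  rw [hind]
  exact h

theorem BasicLimitSet.measurableSet {X : Type*} [PseudoMetricSpace X] [BasicPoints X]
    [MeasurableSpace X] [BorelSpace X] {B : Set X} (hB : BasicLimitSet B) :
    MeasurableSet B := by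
  obtain ⟨e, -, he'⟩ := hB
  have hm : Measurable (B.indicator (fun _ => (1 : ℝ))) :=
    measurable_of_tendsto_metrizable (fun n => (e n).continuous_eval.measurable)
      (tendsto_pi_nhds.2 he')
  have : B = B.indicator (fun _ => (1 : ℝ)) ⁻¹' {1} := by
    ext x
    by_cases h : x ∈ B <;> simp [h]
  rw [this]
  exact hm (measurableSet_singleton _)

theorem BasicLimitSet.tendsto_integral {X : Type*} [PseudoMetricSpace X] [BasicPoints X]
    [MeasurableSpace X] [BorelSpace X] {B : Set X} (hBm : MeasurableSet B) (e : ℕ → BasicExpr)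
    (he : ∀ n (x : X), 0 ≤ (e n).eval x ∧ (e n).eval x ≤ 1)
    (he' : ∀ x : X, Tendsto (fun n => (e n).eval x) atTop
      (𝓝 (B.indicator (fun _ => (1 : ℝ)) x))) (μ : FinMeas X) :
    Tendsto (fun n => ∫ x, (e n).eval x ∂μ.toMeasure) atTop (𝓝 (μ.toMeasure.real B)) := by
  have h := tendsto_integral_of_dominated_convergence (μ := μ.toMeasure) (fun _ => (1 : ℝ))
    (fun n => (e n).continuous_eval.measurable.aestronglyMeasurable)
    (integrable_const _)
    (fun n => Eventually.of_forall fun x => by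
      rw [Real.norm_eq_abs, abs_of_nonneg (he n x).1]; exact (he n x).2)
    (Eventually.of_forall he')
  have h2 : ∫ x, B.indicator (fun _ => (1 : ℝ)) x ∂μ.toMeasure = μ.toMeasure.real B := by
    rw [integral_indicator hBm]; simp
  rwa [h2] at h

/-- A finite measure is determined by its integrals of basic functions. -/
theorem basicIntegral_injective {X : Type*} [ComputableMetricSpace X]
    [MeasurableSpace X] [BorelSpace X] (μ ν : FinMeas X)
    (h : ∀ i, basicIntegral i μ = basicIntegral i ν) : μ = ν := by
  have hint : ∀ e : BasicExpr,
      ∫ x : X, e.eval x ∂μ.toMeasure = ∫ x : X, e.eval x ∂ν.toMeasure := by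
    intro e
    obtain ⟨i, rfl⟩ := BasicExpr.ofNat_surjective e
    exact h i
  have hsets : ∀ B : Set X, BasicLimitSet B → μ.toMeasure B = ν.toMeasure B := by
    intro B hB
    have hBm := hB.measurableSet
    obtain ⟨e, he, he'⟩ := hB
    have h1 := BasicLimitSet.tendsto_integral hBm e he he' μ
    have h2 := BasicLimitSet.tendsto_integral hBm e he he' ν
    simp only [hint] at h1
    exact (measureReal_eq_measureReal_iff).1 (tendsto_nhds_unique h1 h2)
  have huniv : BasicLimitSet (Set.univ : Set X) :=
    ⟨fun _ => .one, fun _ _ => ⟨zero_le_one, le_rfl⟩, fun x => by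
      simp [BasicExpr.eval]⟩
  have hbasis : TopologicalSpace.IsTopologicalBasis
      {B : Set X | IsOpen B ∧ BasicLimitSet B} := by
    refine TopologicalSpace.isTopologicalBasis_of_isOpen_of_nhds (fun u hu => hu.1) ?_
    intro a u ha hu
    obtain ⟨ε, hε, hεu⟩ := Metric.isOpen_iff.1 hu a ha
    obtain ⟨N, hN⟩ := exists_nat_one_div_lt (half_pos hε)
    obtain ⟨i, hi⟩ := (ComputableMetricSpace.dense (X := X)).exists_dist_lt a
      (Nat.one_div_pos_of_nat (α := ℝ) (n := N))
    refine ⟨Metric.ball (BasicPoints.basicPt i) (1 / ((N : ℝ) + 1)),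
      ⟨Metric.isOpen_ball, basicLimitSet_ball i N⟩, hi, fun y hy => hεu ?_⟩
    rw [Metric.mem_ball] at hy ⊢
    have := dist_triangle_right y a (BasicPoints.basicPt i : X)
    linarith
  have : SecondCountableTopology X := by
    have : TopologicalSpace.SeparableSpace X :=
      ⟨Set.range (BasicPoints.basicPt : ℕ → X), Set.countable_range _,
        ComputableMetricSpace.dense⟩
    exact UniformSpace.secondCountable_of_separable X
  have hgen : ‹MeasurableSpace X› =
      MeasurableSpace.generateFrom {B : Set X | IsOpen B ∧ BasicLimitSet B} := by
    rw [BorelSpace.measurable_eq (α := X)]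
    exact hbasis.borel_eq_generateFrom
  refine Subtype.ext (ext_of_generate_finite (μ := μ.toMeasure) (ν := ν.toMeasure) _ hgen
    (fun B hB C hC _ => ⟨hB.1.inter hC.1, hB.2.inter hC.2⟩)
    (fun B hB => hsets B hB.2) (hsets _ huniv))

instance {X : Type*} [ComputableMetricSpace X] [MeasurableSpace X] [BorelSpace X] :
    MetricSpace (FinMeas X) where
  dist := measDist
  dist_self μ := by simp [measDist]
  dist_comm μ ν := by simp only [measDist, abs_sub_comm]
  dist_triangle μ ν ρ := by
    unfold measDist
    rw [← (measDist_summable μ ν).tsum_add (measDist_summable ν ρ)]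
    refine (measDist_summable μ ρ).tsum_le_tsum (fun i => ?_)
      ((measDist_summable μ ν).add (measDist_summable ν ρ))
    rw [← mul_add]
    exact mul_le_mul_of_nonneg_left (one_sub_exp_triangle _ _ _) (by positivity)
  eq_of_dist_eq_zero {μ ν} h :=
    basicIntegral_injective μ ν (basicIntegral_eq_of_measDist_eq_zero μ ν h)

/-- The measure `q δ_x` with `q` a positive rational and `x` a basic point, coded by `k`. -/
def basicAtom (X : Type*) [BasicPoints X] [MeasurableSpace X] (k : ℕ) : FiniteMeasure X :=
  let δ : FiniteMeasure X := ⟨Measure.dirac (BasicPoints.basicPt k.unpair.2), inferInstance⟩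
  (posRat k.unpair.1 : NNReal) • δ

/-- The basic points of the space of measures: the finite (non-empty) sums
`q₁ δ_{x₁} + … + qₙ δ_{xₙ}` with positive rationals `qⱼ` and basic points `xⱼ`. -/
instance {X : Type*} [BasicPoints X] [MeasurableSpace X] : BasicPoints (FinMeas X) :=
  ⟨fun n => (basicAtom X n.unpair.1 +
    ((Denumerable.ofNat (List ℕ) n.unpair.2).map (basicAtom X)).sum : FiniteMeasure X)⟩

/-! ## Uniform tests and randomness -/

/-- `t` is a uniform Schnorr integral test. -/
structure IsUniformSchnorrIntegralTest {A X : Type*} [ComputableMetricSpace A]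
    [ComputableMetricSpace X] [MeasurableSpace X] [BorelSpace X]
    (t : A × FinMeas X × X → ENNReal) : Prop where
  lowerSemicomputable : LowerSemicomputable t
  integral_lt_top : ∀ (a : A) (μ : FinMeas X), ∫⁻ x, t (a, μ, x) ∂μ.toMeasure < ⊤
  computable_integral : ComputableMap fun p : A × FinMeas X =>
    (∫⁻ x, t (p.1, p.2, x) ∂p.2.toMeasure).toReal

/-- The points uniformly Schnorr `μ`-random relative to the oracle `a`. -/
def SR {A X : Type*} [ComputableMetricSpace A] [ComputableMetricSpace X] [MeasurableSpace X]
    [BorelSpace X] (a : A) (μ : FinMeas X) : Set X :=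
  {x | ∀ t : A × FinMeas X × X → ENNReal, IsUniformSchnorrIntegralTest t → t (a, μ, x) < ⊤}

/-- `P` is a uniform Kurtz test. -/
structure IsUniformKurtzTest {A X : Type*} [ComputableMetricSpace A]
    [ComputableMetricSpace X] [MeasurableSpace X] [BorelSpace X]
    (P : Set (A × FinMeas X × X)) : Prop where
  effectivelyClosed : EffectivelyClosed P
  measure_eq_zero : ∀ (a : A) (μ : FinMeas X), μ.toMeasure {x | (a, μ, x) ∈ P} = 0

/-- The points uniformly Kurtz `μ`-random relative to the oracle `a`. -/
def KR {A X : Type*} [ComputableMetricSpace A] [ComputableMetricSpace X] [MeasurableSpace X]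
    [BorelSpace X] (a : A) (μ : FinMeas X) : Set X :=
  {x | ∀ P : Set (A × FinMeas X × X), IsUniformKurtzTest P → (a, μ, x) ∉ P}

end

/-! Write the complement of a Kurtz test P as a union of basic balls. The functions `openApprox I n`
increase pointwise to the indicator of this union and are computable in (a, μ, x), so the deficits
ε_n(a, μ) = ∫ (1 - openApprox I n) dμ decrease to 0, because all sections of P are null sets. Some
weighted sum of the functions 1 - openApprox I n should have a computable integral and yet be
infinite on P. Choosing n_k with ε_{n_k} < 2⁻ᵏ would make the sum depend on the Cauchy names of a
and μ, not only on the points, so weights are needed that are functions of (a, μ) themselves.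

The Abel–Dini series provides them. Put e_n = ε_n + 2⁻ⁿ, which is positive and decreases to 0, and
w_n = e_n / e_{n+1} - 1. Then w_n ε_{n+1} ≤ w_n e_{n+1} = e_n - e_{n+1}, so ∑ w_n ε_{n+1} converges
and its tail from N on is at most e_N (`abelDini_tsum_le`), while ∑ w_n diverges, since the product
of the ratios e_n / e_{n+1} does (`abelDini_not_summable`). The test is t = ∑ w_n (1 - openApprox I
(n+1)). Its integral is ∑ w_n ε_{n+1}, computable thanks to the computable error bound e_N; at
points of P every `openApprox` vanishes, so t = ∑ w_n = ∞ (`schnorrTest_eq_top`).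

Computability is handled through cuts: in `RealComputable`, the relations q < F and F < q for
rational q can be verified from finite parts of names, and `RealComputable.computableMap` turns this
back into a map on names. The analytic core is `RealComputable.integral_truncSup`: `openApprox` is a
finite maximum of terms min(height(a, μ), bump(x)), and once the real heights are replaced by nearby
rationals this is a basic function, whose integral can be read off from a name of μ. The metric on
measures enters only through the upper bounds `distBound`, which suffice to verify membership in an
open ball. -/

noncomputable section

/-! ## Composition rules for computable functions -/

attribute [fun_prop] Computable
attribute [fun_prop] Computable.id Computable.const Computable.comp
attribute [fun_prop] Computable.pair Computable.fst Computable.snd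

namespace Computable

variable {α β γ σ : Type*} [Primcodable α] [Primcodable β] [Primcodable γ] [Primcodable σ]

@[fun_prop]
theorem fst' {f : α → β × γ} (hf : Computable f) : Computable fun a => (f a).1 :=
  Computable.fst.comp hf

@[fun_prop]
theorem snd' {f : α → β × γ} (hf : Computable f) : Computable fun a => (f a).2 :=
  Computable.snd.comp hf

@[fun_prop]
theorem natAdd {f g : α → ℕ} (hf : Computable f) (hg : Computable g) :
    Computable fun a => f a + g a :=
  (Primrec.nat_add.to_comp).comp hf hg

@[fun_prop]
theorem natSub {f g : α → ℕ} (hf : Computable f) (hg : Computable g) :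
    Computable fun a => f a - g a :=
  (Primrec.nat_sub.to_comp).comp hf hg

@[fun_prop]
theorem natMul {f g : α → ℕ} (hf : Computable f) (hg : Computable g) :
    Computable fun a => f a * g a :=
  (Primrec.nat_mul.to_comp).comp hf hg

@[fun_prop]
theorem natDiv {f g : α → ℕ} (hf : Computable f) (hg : Computable g) :
    Computable fun a => f a / g a :=
  (Primrec.nat_div.to_comp).comp hf hg

@[fun_prop]
theorem natMod {f g : α → ℕ} (hf : Computable f) (hg : Computable g) :
    Computable fun a => f a % g a :=
  (Primrec.nat_mod.to_comp).comp hf hg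

@[fun_prop]
theorem natPow {f g : α → ℕ} (hf : Computable f) (hg : Computable g) :
    Computable fun a => f a ^ g a :=
  (Primrec₂.unpaired'.1 Nat.Primrec.pow).to_comp.comp hf hg

@[fun_prop]
theorem natUnpair {f : α → ℕ} (hf : Computable f) : Computable fun a => (f a).unpair :=
  Computable.unpair.comp hf

@[fun_prop]
theorem natPair {f g : α → ℕ} (hf : Computable f) (hg : Computable g) :
    Computable fun a => Nat.pair (f a) (g a) :=
  (Primrec₂.natPair.to_comp).comp hf hg

@[fun_prop]
theorem natBle {f g : α → ℕ} (hf : Computable f) (hg : Computable g) :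
    Computable fun a => Nat.ble (f a) (g a) :=
  ((Primrec.nat_le.decide.to_comp).comp hf hg).of_eq fun a => by
    rw [Bool.eq_iff_iff]; simp

@[fun_prop]
theorem natBeq {f g : α → ℕ} (hf : Computable f) (hg : Computable g) :
    Computable fun a => Nat.beq (f a) (g a) :=
  ((Primrec.eq.decide.to_comp).comp hf hg).of_eq fun a => by
    rw [Bool.eq_iff_iff]; simp

@[fun_prop]
theorem boolAnd {f g : α → Bool} (hf : Computable f) (hg : Computable g) :
    Computable fun a => f a && g a :=
  (Primrec.and.to_comp).comp hf hg

@[fun_prop]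
theorem boolOr {f g : α → Bool} (hf : Computable f) (hg : Computable g) :
    Computable fun a => f a || g a :=
  (Primrec.or.to_comp).comp hf hg

@[fun_prop]
theorem boolNot {f : α → Bool} (hf : Computable f) : Computable fun a => !f a :=
  (Primrec.not.to_comp).comp hf

@[fun_prop]
theorem boolCond {c : α → Bool} {f g : α → σ} (hc : Computable c) (hf : Computable f)
    (hg : Computable g) : Computable fun a => bif c a then f a else g a :=
  Computable.cond hc hf hg

@[fun_prop]
theorem listLength {f : α → List β} (hf : Computable f) : Computable fun a => (f a).length :=
  Computable.list_length.comp hf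

@[fun_prop]
theorem listTake {f : α → List β} {n : α → ℕ} (hf : Computable f) (hn : Computable n) :
    Computable fun a => (f a).take (n a) :=
  (Primrec.list_take.to_comp).comp hn hf

@[fun_prop]
theorem listGetD {f : α → List β} {n : α → ℕ} (d : β) (hf : Computable f) (hn : Computable n) :
    Computable fun a => (f a).getD (n a) d :=
  ((Primrec.list_getD d).to_comp).comp hf hn

@[fun_prop]
theorem listMap {f : β → γ} {l : α → List β} (hf : Primrec f) (hl : Computable l) :
    Computable fun a => (l a).map f :=
  (Primrec.list_map Primrec.id (hf.comp Primrec.snd).to₂).to_comp.comp hl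

@[fun_prop]
theorem decode' {f : α → ℕ} (hf : Computable f) :
    Computable fun a => (Encodable.decode (f a) : Option β) :=
  Computable.decode.comp hf

@[fun_prop]
theorem denumerableOfNat {f : α → ℕ} (hf : Computable f) :
    Computable fun a => Denumerable.ofNat (List ℕ) (f a) :=
  (Computable.ofNat (List ℕ)).comp hf

@[fun_prop]
theorem some' {f : α → β} (hf : Computable f) : Computable fun a => some (f a) :=
  Computable.option_some.comp hf

/-- Primitive recursion with parameters, for uncurried step functions. -/
theorem natRec {n : α → ℕ} {f : α → σ} {g : α × ℕ × σ → σ} (hn : Computable n)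
    (hf : Computable f) (hg : Computable g) :
    Computable fun a => Nat.rec (motive := fun _ => σ) (f a) (fun m s => g (a, m, s)) (n a) :=
  Computable.nat_rec hn hf hg.to₂

theorem optionElim {o : α → Option β} {f : α → σ} {g : α × β → σ} (ho : Computable o)
    (hf : Computable f) (hg : Computable g) :
    Computable fun a => (o a).elim (f a) fun b => g (a, b) :=
  (Computable.option_casesOn ho hf hg.to₂).of_eq fun a => by cases o a <;> rfl

end Computable

/-! ## Arithmetic on codes of rationals -/

/-- The real number coded by `n`. -/
def codeReal (n : ℕ) : ℝ := (ratOfCode n : ℝ)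

theorem codeReal_eq (n : ℕ) : codeReal n =
    ((n.unpair.1.unpair.1 : ℝ) - n.unpair.1.unpair.2) / ((n.unpair.2 : ℝ) + 1) := by
  simp [codeReal, ratOfCode]

def mkCode (p q r : ℕ) : ℕ := Nat.pair (Nat.pair p q) r

@[simp]
theorem codeReal_mkCode (p q r : ℕ) : codeReal (mkCode p q r) = ((p : ℝ) - q) / ((r : ℝ) + 1) := by
  simp [codeReal_eq, mkCode]

/-- Codes store the denominator minus one, and (r + 1)(s + 1) - 1 = rs + r + s. No reduction to
lowest terms is needed, as codes are not required to be unique. -/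
def addCode (a b : ℕ) : ℕ :=
  mkCode (a.unpair.1.unpair.1 * (b.unpair.2 + 1) + b.unpair.1.unpair.1 * (a.unpair.2 + 1))
    (a.unpair.1.unpair.2 * (b.unpair.2 + 1) + b.unpair.1.unpair.2 * (a.unpair.2 + 1))
    (a.unpair.2 * b.unpair.2 + a.unpair.2 + b.unpair.2)

def mulCode (a b : ℕ) : ℕ :=
  mkCode (a.unpair.1.unpair.1 * b.unpair.1.unpair.1 + a.unpair.1.unpair.2 * b.unpair.1.unpair.2)
    (a.unpair.1.unpair.1 * b.unpair.1.unpair.2 + a.unpair.1.unpair.2 * b.unpair.1.unpair.1)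
    (a.unpair.2 * b.unpair.2 + a.unpair.2 + b.unpair.2)

def negCode (a : ℕ) : ℕ := mkCode a.unpair.1.unpair.2 a.unpair.1.unpair.1 a.unpair.2

def leCode (a b : ℕ) : Bool :=
  Nat.ble (a.unpair.1.unpair.1 * (b.unpair.2 + 1) + b.unpair.1.unpair.2 * (a.unpair.2 + 1))
    (b.unpair.1.unpair.1 * (a.unpair.2 + 1) + a.unpair.1.unpair.2 * (b.unpair.2 + 1))

def maxCode (a b : ℕ) : ℕ := bif leCode a b then b else a

def minCode (a b : ℕ) : ℕ := bif leCode a b then a else b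

def natCode (n : ℕ) : ℕ := mkCode n 0 0

def posCode (n : ℕ) : ℕ := mkCode (n.unpair.1 + 1) 0 n.unpair.2

def invPosCode (n : ℕ) : ℕ := mkCode (n.unpair.2 + 1) 0 n.unpair.1

def halfPowCode (n : ℕ) : ℕ := mkCode 1 0 (2 ^ n - 1)

def powCode (a n : ℕ) : ℕ := Nat.rec (natCode 1) (fun _ c => mulCode c a) n

@[simp]
theorem codeReal_addCode (a b : ℕ) : codeReal (addCode a b) = codeReal a + codeReal b := by
  simp only [addCode, codeReal_mkCode, codeReal_eq a, codeReal_eq b]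
  push_cast
  have ha : (a.unpair.2 : ℝ) + 1 ≠ 0 := by positivity
  have hb : (b.unpair.2 : ℝ) + 1 ≠ 0 := by positivity
  have hab : (a.unpair.2 : ℝ) * b.unpair.2 + a.unpair.2 + b.unpair.2 + 1 ≠ 0 := by positivity
  field_simp
  ring

@[simp]
theorem codeReal_mulCode (a b : ℕ) : codeReal (mulCode a b) = codeReal a * codeReal b := by
  simp only [mulCode, codeReal_mkCode, codeReal_eq a, codeReal_eq b]
  push_cast
  have ha : (a.unpair.2 : ℝ) + 1 ≠ 0 := by positivity
  have hb : (b.unpair.2 : ℝ) + 1 ≠ 0 := by positivity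
  have hab : (a.unpair.2 : ℝ) * b.unpair.2 + a.unpair.2 + b.unpair.2 + 1 ≠ 0 := by positivity
  field_simp
  ring

@[simp]
theorem codeReal_negCode (a : ℕ) : codeReal (negCode a) = -codeReal a := by
  simp only [negCode, codeReal_mkCode, codeReal_eq a]
  ring

theorem leCode_iff (a b : ℕ) : leCode a b = true ↔ codeReal a ≤ codeReal b := by
  have ha : 0 < (a.unpair.2 : ℝ) + 1 := by positivity
  have hb : 0 < (b.unpair.2 : ℝ) + 1 := by positivity
  rw [leCode, Nat.ble_eq, codeReal_eq a, codeReal_eq b, div_le_div_iff₀ ha hb,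
    ← @Nat.cast_le ℝ]
  push_cast
  constructor <;> intro h <;> nlinarith

@[simp]
theorem codeReal_maxCode (a b : ℕ) :
    codeReal (maxCode a b) = max (codeReal a) (codeReal b) := by
  unfold maxCode
  cases h : leCode a b
  · have : ¬ codeReal a ≤ codeReal b := by rw [← leCode_iff, h]; simp
    simp [max_eq_left (not_le.1 this).le]
  · simp [max_eq_right ((leCode_iff a b).1 h)]

@[simp]
theorem codeReal_minCode (a b : ℕ) :
    codeReal (minCode a b) = min (codeReal a) (codeReal b) := by
  unfold minCode
  cases h : leCode a b
  · have : ¬ codeReal a ≤ codeReal b := by rw [← leCode_iff, h]; simp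
    simp [min_eq_right (not_le.1 this).le]
  · simp [min_eq_left ((leCode_iff a b).1 h)]

@[simp]
theorem codeReal_natCode (n : ℕ) : codeReal (natCode n) = n := by simp [natCode]

@[simp]
theorem codeReal_posCode (n : ℕ) : codeReal (posCode n) = (posRat n : ℝ) := by
  simp [posCode, posRat]

@[simp]
theorem codeReal_invPosCode (n : ℕ) : codeReal (invPosCode n) = (posRat n : ℝ)⁻¹ := by
  simp [invPosCode, posRat]

@[simp]
theorem codeReal_halfPowCode (n : ℕ) : codeReal (halfPowCode n) = (2 : ℝ)⁻¹ ^ n := by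
  have : 1 ≤ 2 ^ n := Nat.one_le_two_pow
  simp [halfPowCode, Nat.cast_sub this]

@[simp]
theorem codeReal_powCode (a n : ℕ) : codeReal (powCode a n) = codeReal a ^ n := by
  induction n with
  | zero => simp [powCode]
  | succ n ih =>
    rw [pow_succ, ← ih, ← codeReal_mulCode]
    rfl

theorem exists_codeReal_eq (q : ℚ) : ∃ n, codeReal n = q := by
  -- The numerator is split into its positive and negative parts.
  refine ⟨mkCode q.num.toNat (-q.num).toNat (q.den - 1), ?_⟩
  rw [codeReal_mkCode, Nat.cast_sub q.den_pos]
  have h : ((q.num.toNat : ℝ) - (-q.num).toNat) = (q.num : ℝ) := by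
    have := Int.toNat_sub_toNat_neg q.num
    exact_mod_cast this
  rw [h]
  push_cast
  rw [sub_add_cancel]
  exact (Rat.cast_def q).symm

theorem exists_codeReal_between {x y : ℝ} (h : x < y) : ∃ n, x < codeReal n ∧ codeReal n < y := by
  obtain ⟨q, h1, h2⟩ := exists_rat_btwn h
  obtain ⟨n, hn⟩ := exists_codeReal_eq q
  exact ⟨n, by rwa [hn], by rwa [hn]⟩

theorem posRat_pos (n : ℕ) : (0 : ℝ) < (posRat n : ℝ) := by
  simp only [posRat]
  push_cast
  positivity

namespace Computable

variable {α : Type*} [Primcodable α] {f g h : α → ℕ}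

@[fun_prop]
theorem mkCode (hf : Computable f) (hg : Computable g) (hh : Computable h) :
    Computable fun a => mkCode (f a) (g a) (h a) := by
  unfold _root_.mkCode; fun_prop

@[fun_prop]
theorem addCode (hf : Computable f) (hg : Computable g) :
    Computable fun a => addCode (f a) (g a) := by
  unfold _root_.addCode; fun_prop

@[fun_prop]
theorem mulCode (hf : Computable f) (hg : Computable g) :
    Computable fun a => mulCode (f a) (g a) := by
  unfold _root_.mulCode; fun_prop

@[fun_prop]
theorem negCode (hf : Computable f) : Computable fun a => negCode (f a) := by
  unfold _root_.negCode; fun_prop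

@[fun_prop]
theorem leCode (hf : Computable f) (hg : Computable g) :
    Computable fun a => leCode (f a) (g a) := by
  unfold _root_.leCode; fun_prop

@[fun_prop]
theorem maxCode (hf : Computable f) (hg : Computable g) :
    Computable fun a => maxCode (f a) (g a) := by
  unfold _root_.maxCode; fun_prop

@[fun_prop]
theorem minCode (hf : Computable f) (hg : Computable g) :
    Computable fun a => minCode (f a) (g a) := by
  unfold _root_.minCode; fun_prop

@[fun_prop]
theorem natCode (hf : Computable f) : Computable fun a => natCode (f a) := by
  unfold _root_.natCode; fun_prop

@[fun_prop]
theorem posCode (hf : Computable f) : Computable fun a => posCode (f a) := by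
  unfold _root_.posCode; fun_prop

@[fun_prop]
theorem invPosCode (hf : Computable f) : Computable fun a => invPosCode (f a) := by
  unfold _root_.invPosCode; fun_prop

@[fun_prop]
theorem halfPowCode (hf : Computable f) : Computable fun a => halfPowCode (f a) := by
  unfold _root_.halfPowCode; fun_prop

@[fun_prop]
theorem powCode (hf : Computable f) (hg : Computable g) :
    Computable fun a => powCode (f a) (g a) :=
  Computable.natRec hg (Computable.const _) (g := fun p => _root_.mulCode p.2.2 (f p.1))
    (by fun_prop)

end Computable

theorem Computable.rangeAny {α : Type*} [Primcodable α] {f : α × ℕ → Bool} {n : α → ℕ}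
    (hf : Computable f) (hn : Computable n) :
    Computable fun a => (List.range (n a)).any fun i => f (a, i) :=
  (Computable.natRec (f := fun _ => false) (g := fun q : α × ℕ × Bool => q.2.2 || f (q.1, q.2.1))
    hn (by fun_prop) (by fun_prop)).of_eq fun a => by
      induction n a with
      | zero => rfl
      | succ n ih => simp [ih, List.range_succ]

theorem Computable.rangeAll {α : Type*} [Primcodable α] {f : α × ℕ → Bool} {n : α → ℕ}
    (hf : Computable f) (hn : Computable n) :
    Computable fun a => (List.range (n a)).all fun i => f (a, i) :=
  (Computable.natRec (f := fun _ => true) (g := fun q : α × ℕ × Bool => q.2.2 && f (q.1, q.2.1))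
    hn (by fun_prop) (by fun_prop)).of_eq fun a => by
      induction n a with
      | zero => rfl
      | succ n ih => simp [ih, List.range_succ]

/-! ## Semidecidable relations between codes and points given by Cauchy names -/

/-- The initial segment of length `k`. -/
def initSeg (h : ℕ → ℕ) (k : ℕ) : List ℕ := (List.range k).map h

@[simp]
theorem initSeg_length (h : ℕ → ℕ) (k : ℕ) : (initSeg h k).length = k := by simp [initSeg]

theorem initSeg_take (h : ℕ → ℕ) {k m : ℕ} (hkm : k ≤ m) :
    (initSeg h m).take k = initSeg h k := by
  simp [initSeg, ← List.map_take, List.take_range, hkm]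

theorem initSeg_map (h p : ℕ → ℕ) (k : ℕ) : (initSeg h k).map p = initSeg (p ∘ h) k := by
  simp [initSeg]

theorem initSeg_getD (h : ℕ → ℕ) {k m : ℕ} (hkm : k < m) (d : ℕ) :
    (initSeg h m).getD k d = h k := by
  simp [initSeg, hkm]

/-- The relation `W` between elements of a coded type and points of `Y` can be verified by
reading initial segments of Cauchy names of the points. -/
def SemiDec {α Y : Type*} [Primcodable α] [PseudoMetricSpace Y] [BasicPoints Y]
    (W : α → Y → Prop) : Prop :=
  ∃ D : α × List ℕ → Bool, Computable D ∧
    ∀ (y : Y) (h : ℕ → ℕ), IsCauchyName h y → ∀ a, W a y ↔ ∃ k, D (a, initSeg h k) = true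

namespace SemiDec

variable {α β Y Z : Type*} [Primcodable α] [Primcodable β] [PseudoMetricSpace Y] [BasicPoints Y]
  [PseudoMetricSpace Z] [BasicPoints Z] {V W : α → Y → Prop}

theorem of_iff (hV : SemiDec V) (h : ∀ a y, W a y ↔ V a y) : SemiDec W := by
  obtain rfl : W = V := by ext; exact h _ _
  exact hV

theorem of_bool {b : α → Bool} (hb : Computable b) : SemiDec fun a (_ : Y) => b a = true :=
  ⟨fun p => b p.1, by fun_prop, fun _ _ _ _ => by simp⟩

theorem comp (hW : SemiDec W) {f : β → α} (hf : Computable f) :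
    SemiDec fun b y => W (f b) y := by
  obtain ⟨D, hD, h⟩ := hW
  exact ⟨fun p => D (f p.1, p.2), by fun_prop, fun y n hn b => h y n hn (f b)⟩

/-- Dovetailing: acceptance need not persist on longer segments, so the length of the segment is
decoded as a pair of lengths, one for each procedure, and every pair of lengths is tried. -/
theorem and (hV : SemiDec V) (hW : SemiDec W) : SemiDec fun a y => V a y ∧ W a y := by
  obtain ⟨D, hD, h⟩ := hV
  obtain ⟨E, hE, h'⟩ := hW
  refine ⟨fun p => D (p.1, p.2.take p.2.length.unpair.1) && E (p.1, p.2.take p.2.length.unpair.2),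
    by fun_prop, fun y n hn a => ?_⟩
  simp only [h y n hn, h' y n hn]
  simp only [Bool.and_eq_true, initSeg_length, initSeg_take n (Nat.unpair_left_le _),
    initSeg_take n (Nat.unpair_right_le _)]
  exact ⟨fun ⟨⟨i, hi⟩, j, hj⟩ => ⟨Nat.pair i j, by simpa using ⟨hi, hj⟩⟩,
    fun ⟨k, h1, h2⟩ => ⟨⟨_, h1⟩, _, h2⟩⟩

theorem or (hV : SemiDec V) (hW : SemiDec W) : SemiDec fun a y => V a y ∨ W a y := by
  obtain ⟨D, hD, h⟩ := hV
  obtain ⟨E, hE, h'⟩ := hW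
  refine ⟨fun p => D p || E p, by fun_prop, fun y n hn a => ?_⟩
  simp only [h y n hn, h' y n hn]
  simp only [Bool.or_eq_true, exists_or]

/-- The length of the segment codes both a candidate witness and the length on which to test it.
This is the unbounded search behind all later constructions with rational bounds. -/
theorem exists_code {R : α × β → Y → Prop} (hR : SemiDec R) :
    SemiDec fun a y => ∃ b, R (a, b) y := by
  obtain ⟨D, hD, h⟩ := hR
  refine ⟨fun p => (Encodable.decode (α := β) p.2.length.unpair.1).elim false fun b =>
    D ((p.1, b), p.2.take p.2.length.unpair.2),
    Computable.optionElim
      (g := fun q : (α × List ℕ) × β => D ((q.1.1, q.2), q.1.2.take q.1.2.length.unpair.2))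
      (by fun_prop) (by fun_prop) (by fun_prop), fun y n hn a => ?_⟩
  simp only [h y n hn, initSeg_length, initSeg_take n (Nat.unpair_right_le _)]
  constructor
  · rintro ⟨b, k, hk⟩
    exact ⟨Nat.pair (Encodable.encode b) k, by simpa using hk⟩
  · rintro ⟨k, hk⟩
    cases hb : (Encodable.decode (α := β) k.unpair.1) with
    | none => simp [hb] at hk
    | some b => exact ⟨b, _, by simpa [hb] using hk⟩

/-- Accepting as soon as some shorter segment has been accepted makes acceptance persistent, so that
finitely many searches can share one length. -/
theorem exists_monotone (hW : SemiDec W) : ∃ D : α × List ℕ → Bool, Computable D ∧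
    (∀ (h : ℕ → ℕ) (a : α) (k m : ℕ), k ≤ m → D (a, initSeg h k) = true →
      D (a, initSeg h m) = true) ∧
    ∀ (y : Y) (h : ℕ → ℕ), IsCauchyName h y →
      ∀ a, W a y ↔ ∃ k, D (a, initSeg h k) = true := by
  obtain ⟨D, hD, h⟩ := hW
  let E : α × List ℕ → Bool := fun p => (List.range (p.2.length + 1)).any fun m =>
    D (p.1, p.2.take m)
  have hEc : Computable E := Computable.rangeAny
    (f := fun q : (α × List ℕ) × ℕ => D (q.1.1, q.1.2.take q.2)) (by fun_prop) (by fun_prop)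
  have hE' : ∀ (g : ℕ → ℕ) a m, E (a, initSeg g m) = true ↔ ∃ k ≤ m, D (a, initSeg g k) = true := by
    intro g a m
    simp only [E, List.any_eq_true, List.mem_range, initSeg_length, Nat.lt_succ_iff]
    exact exists_congr fun k => and_congr_right fun hk => by rw [initSeg_take g hk]
  refine ⟨E, hEc, fun g a k m hkm => ?_, fun y g hg a => ?_⟩
  · rw [hE', hE']
    exact fun ⟨i, hi, hi'⟩ => ⟨i, hi.trans hkm, hi'⟩
  · simp only [h y g hg, hE']
    exact ⟨fun ⟨k, hk⟩ => ⟨k, k, le_rfl, hk⟩, fun ⟨_, k, _, hk⟩ => ⟨k, hk⟩⟩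

theorem forall_lt {R : α × ℕ → Y → Prop} (hR : SemiDec R) {N : α → ℕ} (hN : Computable N) :
    SemiDec fun a y => ∀ i < N a, R (a, i) y := by
  obtain ⟨D, hD, hm, h⟩ := hR.exists_monotone
  refine ⟨fun p => (List.range (N p.1)).all fun m => D ((p.1, m), p.2),
    Computable.rangeAll (f := fun q : (α × List ℕ) × ℕ => D ((q.1.1, q.2), q.1.2))
      (by fun_prop) (by fun_prop), fun y g hg a => ?_⟩
  simp only [List.all_eq_true, List.mem_range, h y g hg]
  constructor
  · intro H
    choose! k hk using H
    -- The largest of the finitely many lengths serves all indices, by persistence.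
    refine ⟨(Finset.range (N a)).sup k, fun i hi => hm g _ _ _ ?_ (hk i hi)⟩
    exact Finset.le_sup (Finset.mem_range.2 hi)
  · exact fun ⟨k, hk⟩ i hi => ⟨k, hk i hi⟩

theorem comp_point (hW : SemiDec W) {π : Z → Y} {p : ℕ → ℕ} (hp : Primrec p)
    (hπ : ∀ h z, IsCauchyName h z → IsCauchyName (p ∘ h) (π z)) :
    SemiDec fun a z => W a (π z) := by
  obtain ⟨D, hD, h⟩ := hW
  refine ⟨fun q => D (q.1, q.2.map p), by fun_prop, fun z g hg a => ?_⟩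
  simp only [h _ _ (hπ g z hg), initSeg_map]

/-- A relation that holds for `y` if and only if it is witnessed by an entry of each name. -/
theorem of_name {V : α × ℕ × ℕ → Prop} (hV : SemiDec fun p (_ : ℕ) => V p)
    (h : ∀ y g, IsCauchyName g y → ∀ a, W a y ↔ ∃ j, V (a, j, g j)) : SemiDec W := by
  obtain ⟨D, hD, hm, hVD⟩ := hV.exists_monotone
  -- The relation `V` ignores the point, so its procedure may be fed the constant name of `0`. The
  -- given name only supplies the entry `g j`.
  have hz : IsCauchyName (fun _ => 0) (0 : ℕ) :=
    ⟨fun i j _ => by simp, by simp [BasicPoints.basicPt]⟩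
  have hV' := hVD 0 _ hz
  have hseg : ∀ (g : ℕ → ℕ) k, (initSeg g k).map (fun _ => 0) = initSeg (fun _ => 0) k :=
    fun g k => initSeg_map g _ k
  refine ⟨fun p => Nat.ble (p.2.length.unpair.1 + 1) p.2.length &&
    D ((p.1, p.2.length.unpair.1, p.2.getD p.2.length.unpair.1 0),
      (p.2.take p.2.length.unpair.2).map fun _ => 0), ?_, fun y g hg a => ?_⟩
  · have := Primrec.const (α := ℕ) (0 : ℕ)
    fun_prop
  simp only [h y g hg, hV', initSeg_length, Bool.and_eq_true, Nat.ble_eq,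
    initSeg_take g (Nat.unpair_right_le _), hseg]
  constructor
  · rintro ⟨j, k, hk⟩
    -- The second component is enlarged so that a segment of length `Nat.pair j k'` really contains
    -- the entry with index `j`.
    obtain ⟨k', hk', hj⟩ : ∃ k', D ((a, j, g j), initSeg (fun _ => 0) k') = true ∧
        j < Nat.pair j k' :=
      ⟨max k (j + 1), hm _ _ _ _ (le_max_left _ _) hk,
        (Nat.lt_of_succ_le (le_max_right k (j + 1))).trans_le (Nat.right_le_pair _ _)⟩
    refine ⟨Nat.pair j k', by simpa using Nat.succ_le_of_lt hj, ?_⟩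
    rw [Nat.unpair_pair, initSeg_getD g hj]
    exact hk'
  · rintro ⟨k, h1, h2⟩
    rw [initSeg_getD g h1] at h2
    exact ⟨_, _, h2⟩

end SemiDec

/-! ### Approximation of reals by coded rationals -/

theorem exists_codeReal_lt {x y : ℝ} (h : y < x) {s : Set ℝ} (hs : s ∈ 𝓝 x) :
    ∃ c, y < codeReal c ∧ codeReal c < x ∧ codeReal c ∈ s := by
  obtain ⟨l, hl, hls⟩ := exists_Ioc_subset_of_mem_nhds hs ⟨y, h⟩
  obtain ⟨c, h1, h2⟩ := exists_codeReal_between (max_lt h hl)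
  exact ⟨c, (le_max_left _ _).trans_lt h1, h2, hls ⟨(le_max_right _ _).trans_lt h1, h2.le⟩⟩

theorem exists_codeReal_gt {x : ℝ} {s : Set ℝ} (hs : s ∈ 𝓝 x) :
    ∃ c, x < codeReal c ∧ codeReal c ∈ s := by
  obtain ⟨u, hu, hus⟩ := exists_Ico_subset_of_mem_nhds hs ⟨x + 1, by linarith⟩
  obtain ⟨c, h1, h2⟩ := exists_codeReal_between hu
  exact ⟨c, h1, hus ⟨h1.le, h2⟩⟩

theorem exists_list_codeReal_between {x y : ℕ → ℝ} (h : ∀ i, x i < y i) (n : ℕ) :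
    ∃ L : List ℕ, ∀ i < n, x i < codeReal (L.getD i 0) ∧ codeReal (L.getD i 0) < y i := by
  choose c hc using fun i => exists_codeReal_between (h i)
  exact ⟨initSeg c n, fun i hi => by rw [initSeg_getD c hi]; exact hc i⟩

/-- The code of the sum of the first `n` entries of a list of codes. -/
def sumCode (L : List ℕ) (n : ℕ) : ℕ :=
  Nat.rec (natCode 0) (fun i c => addCode c (L.getD i 0)) n

@[simp]
theorem codeReal_sumCode (L : List ℕ) (n : ℕ) :
    codeReal (sumCode L n) = ∑ i ∈ Finset.range n, codeReal (L.getD i 0) := by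
  induction n with
  | zero => simp [sumCode]
  | succ n ih =>
    rw [Finset.sum_range_succ, ← ih, ← codeReal_addCode]
    rfl

@[fun_prop]
theorem Computable.sumCode {α : Type*} [Primcodable α] {L : α → List ℕ} {n : α → ℕ}
    (hL : Computable L) (hn : Computable n) : Computable fun a => sumCode (L a) (n a) :=
  Computable.natRec hn (Computable.const _)
    (g := fun p => _root_.addCode p.2.2 ((L p.1).getD p.2.1 0)) (by fun_prop)

/-! ### Real functions computable through their cuts -/

variable {α β Y Z : Type*} [Primcodable α] [Primcodable β] [PseudoMetricSpace Y] [BasicPoints Y]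
  [PseudoMetricSpace Z] [BasicPoints Z]

theorem SemiDec.codeReal_le {f g : α → ℕ} (hf : Computable f) (hg : Computable g) :
    SemiDec fun a (_ : Y) => codeReal (f a) ≤ codeReal (g a) :=
  (SemiDec.of_bool (b := fun a => leCode (f a) (g a)) (by fun_prop)).of_iff
    fun a _ => (leCode_iff _ _).symm

theorem SemiDec.codeReal_lt {f g : α → ℕ} (hf : Computable f) (hg : Computable g) :
    SemiDec fun a (_ : Y) => codeReal (f a) < codeReal (g a) :=
  (SemiDec.of_bool (b := fun a => !leCode (g a) (f a)) (by fun_prop)).of_iff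
    fun a _ => by rw [← not_le, ← leCode_iff]; simp

/-- A family of real functions whose values can be computed from the parameter and Cauchy names
of the argument, expressed by the semidecidability of both cuts. -/
structure RealComputable (F : α → Y → ℝ) : Prop where
  lower : SemiDec fun (p : α × ℕ) y => codeReal p.2 < F p.1 y
  upper : SemiDec fun (p : α × ℕ) y => F p.1 y < codeReal p.2

namespace RealComputable

variable {F G : α → Y → ℝ}

theorem lower_comp (hF : RealComputable F) {f : β → α} {q : β → ℕ} (hf : Computable f)
    (hq : Computable q) : SemiDec fun b y => codeReal (q b) < F (f b) y :=
  hF.lower.comp (f := fun b => (f b, q b)) (by fun_prop)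

theorem upper_comp (hF : RealComputable F) {f : β → α} {q : β → ℕ} (hf : Computable f)
    (hq : Computable q) : SemiDec fun b y => F (f b) y < codeReal (q b) :=
  hF.upper.comp (f := fun b => (f b, q b)) (by fun_prop)

theorem of_eq (hF : RealComputable F) (h : ∀ a y, G a y = F a y) : RealComputable G := by
  obtain rfl : G = F := by ext; exact h _ _
  exact hF

theorem comp (hF : RealComputable F) {f : β → α} (hf : Computable f) :
    RealComputable fun b y => F (f b) y :=
  ⟨hF.lower_comp (f := fun p : β × ℕ => f p.1) (by fun_prop) (by fun_prop),
    hF.upper_comp (f := fun p : β × ℕ => f p.1) (by fun_prop) (by fun_prop)⟩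

theorem comp_point (hF : RealComputable F) {π : Z → Y} {p : ℕ → ℕ} (hp : Primrec p)
    (hπ : ∀ h z, IsCauchyName h z → IsCauchyName (p ∘ h) (π z)) :
    RealComputable fun a z => F a (π z) :=
  ⟨hF.lower.comp_point hp hπ, hF.upper.comp_point hp hπ⟩

theorem code {f : α → ℕ} (hf : Computable f) :
    RealComputable fun a (_ : Y) => codeReal (f a) :=
  ⟨SemiDec.codeReal_lt (by fun_prop) (by fun_prop), SemiDec.codeReal_lt (by fun_prop) (by fun_prop)⟩

theorem natCast {f : α → ℕ} (hf : Computable f) :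
    RealComputable fun a (_ : Y) => (f a : ℝ) :=
  (code (f := fun a => natCode (f a)) (by fun_prop)).of_eq fun _ _ => by simp

theorem zero : RealComputable fun (_ : α) (_ : Y) => (0 : ℝ) :=
  (natCast (f := fun _ => 0) (by fun_prop)).of_eq fun _ _ => by simp

theorem one : RealComputable fun (_ : α) (_ : Y) => (1 : ℝ) :=
  (natCast (f := fun _ => 1) (by fun_prop)).of_eq fun _ _ => by simp

theorem posRat {f : α → ℕ} (hf : Computable f) :
    RealComputable fun a (_ : Y) => (posRat (f a) : ℝ) :=
  (code (f := fun a => posCode (f a)) (by fun_prop)).of_eq fun _ _ => by simp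

theorem halfPow {f : α → ℕ} (hf : Computable f) :
    RealComputable fun a (_ : Y) => (2 : ℝ)⁻¹ ^ f a :=
  (code (f := fun a => halfPowCode (f a)) (by fun_prop)).of_eq fun _ _ => by simp

theorem neg (hF : RealComputable F) : RealComputable fun a y => -F a y :=
  ⟨(hF.upper_comp (f := fun p : α × ℕ => p.1) (q := fun p => negCode p.2) (by fun_prop)
      (by fun_prop)).of_iff fun _ _ => by simp [lt_neg],
    (hF.lower_comp (f := fun p : α × ℕ => p.1) (q := fun p => negCode p.2) (by fun_prop)
      (by fun_prop)).of_iff fun _ _ => by simp [neg_lt]⟩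

theorem of_lower (h : SemiDec fun (p : α × ℕ) y => codeReal p.2 < F p.1 y)
    (h' : SemiDec fun (p : α × ℕ) y => codeReal p.2 < -F p.1 y) : RealComputable F :=
  ⟨h, (h'.comp (f := fun p : α × ℕ => (p.1, negCode p.2)) (by fun_prop)).of_iff
    fun p y => by simp⟩

/-- A rational lies below a sum exactly when it is at most r + s for some rationals r and s strictly
below the summands. -/
theorem lower_add (hF : RealComputable F) (hG : RealComputable G) :
    SemiDec fun (p : α × ℕ) y => codeReal p.2 < F p.1 y + G p.1 y := by
  refine ((((hF.lower_comp (f := fun q : (α × ℕ) × ℕ × ℕ => q.1.1) (q := fun q => q.2.1)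
    (by fun_prop) (by fun_prop)).and (hG.lower_comp (f := fun q : (α × ℕ) × ℕ × ℕ => q.1.1)
    (q := fun q => q.2.2) (by fun_prop) (by fun_prop))).and (SemiDec.codeReal_le
      (f := fun q : (α × ℕ) × ℕ × ℕ => q.1.2) (g := fun q => addCode q.2.1 q.2.2)
      (by fun_prop) (by fun_prop))).exists_code).of_iff fun p y => ?_
  constructor
  · intro h
    obtain ⟨r, h1, h2⟩ := exists_codeReal_between (sub_lt_iff_lt_add.2 h)
    obtain ⟨s, h3, h4⟩ := exists_codeReal_between (sub_lt_comm.1 h1)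
    refine ⟨(r, s), ⟨h2, h4⟩, ?_⟩
    simp only [codeReal_addCode]
    linarith
  · rintro ⟨r, ⟨h1, h2⟩, h3⟩
    simp only [codeReal_addCode] at h1 h2 h3
    linarith

theorem add (hF : RealComputable F) (hG : RealComputable G) :
    RealComputable fun a y => F a y + G a y :=
  of_lower (hF.lower_add hG) ((hF.neg.lower_add hG.neg).of_iff fun p y => by rw [neg_add])

theorem sub (hF : RealComputable F) (hG : RealComputable G) :
    RealComputable fun a y => F a y - G a y :=
  (hF.add hG.neg).of_eq fun _ _ => sub_eq_add_neg _ _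

theorem max (hF : RealComputable F) (hG : RealComputable G) :
    RealComputable fun a y => max (F a y) (G a y) :=
  ⟨(hF.lower.or hG.lower).of_iff fun _ _ => lt_max_iff,
    (hF.upper.and hG.upper).of_iff fun _ _ => max_lt_iff⟩

theorem min (hF : RealComputable F) (hG : RealComputable G) :
    RealComputable fun a y => min (F a y) (G a y) :=
  ⟨(hF.lower.and hG.lower).of_iff fun _ _ => lt_min_iff,
    (hF.upper.or hG.upper).of_iff fun _ _ => min_lt_iff⟩

theorem abs (hF : RealComputable F) : RealComputable fun a y => |F a y| :=
  (hF.max hF.neg).of_eq fun _ _ => rfl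

/-- For nonnegative factors multiplication is monotone, so bounds for the product come from rational
bounds for the factors. In the lower cut negative rationals need a separate clause, since a factor
may be 0 and then has no positive rational below it. -/
theorem mul_of_nonneg (hF : RealComputable F) (hG : RealComputable G) (hF0 : ∀ a y, 0 ≤ F a y)
    (hG0 : ∀ a y, 0 ≤ G a y) : RealComputable fun a y => F a y * G a y := by
  constructor
  · refine ((SemiDec.codeReal_lt (f := fun q : α × ℕ => q.2) (g := fun _ => natCode 0)
      (by fun_prop) (by fun_prop)).or
      ((((hF.lower_comp (f := fun q : (α × ℕ) × ℕ × ℕ => q.1.1) (q := fun q => q.2.1)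
      (by fun_prop) (by fun_prop)).and (hG.lower_comp (f := fun q : (α × ℕ) × ℕ × ℕ => q.1.1)
      (q := fun q => q.2.2) (by fun_prop) (by fun_prop))).and ((SemiDec.codeReal_lt
        (f := fun _ : (α × ℕ) × ℕ × ℕ => natCode 0) (g := fun q => q.2.1)
        (by fun_prop) (by fun_prop)).and ((SemiDec.codeReal_lt
        (f := fun _ : (α × ℕ) × ℕ × ℕ => natCode 0) (g := fun q => q.2.2)
        (by fun_prop) (by fun_prop)).and (SemiDec.codeReal_le
        (f := fun q : (α × ℕ) × ℕ × ℕ => q.1.2) (g := fun q => mulCode q.2.1 q.2.2)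
        (by fun_prop) (by fun_prop))))).exists_code)).of_iff fun p y => ?_
    simp only [codeReal_natCode, codeReal_mulCode, Nat.cast_zero]
    constructor
    · intro h
      rcases lt_or_ge (codeReal p.2) 0 with h0 | h0
      · exact Or.inl h0
      have hpos : 0 < F p.1 y * G p.1 y := h0.trans_lt h
      have hFp : 0 < F p.1 y := pos_of_mul_pos_left hpos (hG0 _ _)
      have hGp : 0 < G p.1 y := pos_of_mul_pos_right hpos (hF0 _ _)
      obtain ⟨r, hr0, hr, hr'⟩ := exists_codeReal_lt hFp
        (((continuous_mul_const (G p.1 y)).tendsto _).eventually (lt_mem_nhds h))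
      obtain ⟨s, hs0, hs, hs'⟩ := exists_codeReal_lt hGp
        (((continuous_const_mul (codeReal r)).tendsto _).eventually (lt_mem_nhds hr'))
      exact Or.inr ⟨(r, s), ⟨hr, hs⟩, hr0, hs0, le_of_lt hs'⟩
    · rintro (h | ⟨r, ⟨h1, h2⟩, h3, h4, h5⟩)
      · exact h.trans_le (mul_nonneg (hF0 _ _) (hG0 _ _))
      · exact h5.trans_lt (mul_lt_mul'' h1 h2 h3.le h4.le)
  · refine (((hF.upper_comp (f := fun q : (α × ℕ) × ℕ × ℕ => q.1.1) (q := fun q => q.2.1)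
      (by fun_prop) (by fun_prop)).and ((hG.upper_comp (f := fun q : (α × ℕ) × ℕ × ℕ => q.1.1)
      (q := fun q => q.2.2) (by fun_prop) (by fun_prop)).and (SemiDec.codeReal_le
        (g := fun q : (α × ℕ) × ℕ × ℕ => q.1.2) (f := fun q => mulCode q.2.1 q.2.2)
        (by fun_prop) (by fun_prop)))).exists_code).of_iff fun p y => ?_
    simp only [codeReal_mulCode]
    constructor
    · intro h
      obtain ⟨r, hr, hr'⟩ := exists_codeReal_gt
        (((continuous_mul_const (G p.1 y)).tendsto _).eventually (gt_mem_nhds h))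
      obtain ⟨s, hs, hs'⟩ := exists_codeReal_gt
        (((continuous_const_mul (codeReal r)).tendsto _).eventually (gt_mem_nhds hr'))
      exact ⟨(r, s), hr, hs, le_of_lt hs'⟩
    · rintro ⟨r, h1, h2, h3⟩
      exact (mul_lt_mul'' h1 h2 (hF0 _ _) (hG0 _ _)).trans_le h3

/-- Both factors are split into positive and negative parts, which reduces the claim to nonnegative
factors. -/
theorem mul (hF : RealComputable F) (hG : RealComputable G) :
    RealComputable fun a y => F a y * G a y := by
  have h1 := hF.max zero
  have h2 := hF.neg.max zero
  have h3 := hG.max zero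
  have h4 := hG.neg.max zero
  have hn : ∀ (H : α → Y → ℝ) a y, 0 ≤ Max.max (H a y) 0 := fun _ _ _ => le_max_right _ _
  refine (((h1.mul_of_nonneg h3 (hn _) (hn _)).add (h2.mul_of_nonneg h4 (hn fun a y => -F a y)
    (hn fun a y => -G a y))).sub ((h1.mul_of_nonneg h4 (hn _) (hn fun a y => -G a y)).add
    (h2.mul_of_nonneg h3 (hn fun a y => -F a y) (hn _)))).of_eq fun a y => ?_
  have hd : ∀ x : ℝ, x = Max.max x 0 - Max.max (-x) 0 := fun x => by
    rcases le_total x 0 with h | h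
    · rw [max_eq_right h, max_eq_left (neg_nonneg.2 h)]; ring
    · rw [max_eq_left h, max_eq_right (neg_nonpos.2 h)]; ring
  conv_lhs => rw [hd (F a y), hd (G a y)]
  ring

theorem inv_of_pos (hF : RealComputable F) (hF0 : ∀ a y, 0 < F a y) :
    RealComputable fun a y => (F a y)⁻¹ := by
  constructor
  · refine (((hF.upper_comp (f := fun q : (α × ℕ) × ℕ => q.1.1) (q := fun q => q.2)
      (by fun_prop) (by fun_prop)).and (SemiDec.codeReal_le
        (f := fun q : (α × ℕ) × ℕ => mulCode q.1.2 q.2) (g := fun _ => natCode 1)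
        (by fun_prop) (by fun_prop))).exists_code).of_iff fun p y => ?_
    simp only [codeReal_mulCode, codeReal_natCode, Nat.cast_one]
    have h0 := hF0 p.1 y
    constructor
    · intro h
      have h' : codeReal p.2 * F p.1 y < 1 := by rwa [← lt_div_iff₀ h0, one_div]
      obtain ⟨r, hr, hr'⟩ := exists_codeReal_gt
        (((continuous_const_mul (codeReal p.2)).tendsto _).eventually (gt_mem_nhds h'))
      exact ⟨r, hr, le_of_lt hr'⟩
    · rintro ⟨r, h1, h2⟩
      have : codeReal p.2 ≤ (codeReal r)⁻¹ := by
        rwa [← one_div, le_div_iff₀ (h0.trans h1)]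
      exact this.trans_lt (inv_strictAnti₀ h0 h1)
  · refine (((hF.lower_comp (f := fun q : (α × ℕ) × ℕ => q.1.1) (q := fun q => q.2)
      (by fun_prop) (by fun_prop)).and ((SemiDec.codeReal_lt (f := fun _ : (α × ℕ) × ℕ => natCode 0)
        (g := fun q => q.2) (by fun_prop) (by fun_prop)).and (SemiDec.codeReal_le
        (g := fun q : (α × ℕ) × ℕ => mulCode q.1.2 q.2) (f := fun _ => natCode 1)
        (by fun_prop) (by fun_prop)))).exists_code).of_iff fun p y => ?_
    simp only [codeReal_mulCode, codeReal_natCode, Nat.cast_one, Nat.cast_zero]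
    have h0 := hF0 p.1 y
    constructor
    · intro h
      have h' : 1 < codeReal p.2 * F p.1 y := (inv_lt_iff_one_lt_mul₀ h0).1 h
      obtain ⟨r, hr0, hr, hr'⟩ := exists_codeReal_lt h0
        (((continuous_const_mul (codeReal p.2)).tendsto _).eventually (lt_mem_nhds h'))
      exact ⟨r, hr, hr0, le_of_lt hr'⟩
    · rintro ⟨r, h1, h2, h3⟩
      exact (inv_strictAnti₀ h2 h1).trans_le ((inv_le_iff_one_le_mul₀ h2).2 h3)

/-- The exponent varies with the parameter, so this is not an iteration of `mul`; a single rational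
bound for the base is searched for instead. The exponent `n a + 1` is nonzero, which makes the power
strictly monotone. -/
theorem pow_of_nonneg (hF : RealComputable F) (hF0 : ∀ a y, 0 ≤ F a y) {n : α → ℕ}
    (hn : Computable n) : RealComputable fun a y => F a y ^ (n a + 1) := by
  constructor
  · refine ((SemiDec.codeReal_lt (f := fun q : α × ℕ => q.2) (g := fun _ => natCode 0)
      (by fun_prop) (by fun_prop)).or
      ((hF.lower_comp (f := fun q : (α × ℕ) × ℕ => q.1.1) (q := fun q => q.2)
      (by fun_prop) (by fun_prop)).and ((SemiDec.codeReal_lt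
        (f := fun _ : (α × ℕ) × ℕ => natCode 0) (g := fun q => q.2)
        (by fun_prop) (by fun_prop)).and (SemiDec.codeReal_le
        (f := fun q : (α × ℕ) × ℕ => q.1.2) (g := fun q => powCode q.2 (n q.1.1 + 1))
        (by fun_prop) (by fun_prop)))).exists_code).of_iff fun p y => ?_
    simp only [codeReal_natCode, codeReal_powCode, Nat.cast_zero]
    constructor
    · intro h
      rcases lt_or_ge (codeReal p.2) 0 with h0 | h0
      · exact Or.inl h0
      have hFp : 0 < F p.1 y := (hF0 _ _).lt_of_ne fun h' => by
        rw [← h', zero_pow (Nat.succ_ne_zero _)] at h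
        exact h.not_ge h0
      obtain ⟨r, hr0, hr, hr'⟩ := exists_codeReal_lt hFp
        (((continuous_pow (n p.1 + 1)).tendsto _).eventually (lt_mem_nhds h))
      exact Or.inr ⟨r, hr, hr0, le_of_lt hr'⟩
    · rintro (h | ⟨r, h1, h2, h3⟩)
      · exact h.trans_le (pow_nonneg (hF0 _ _) _)
      · exact h3.trans_lt (pow_lt_pow_left₀ h1 h2.le (Nat.succ_ne_zero _))
  · refine (((hF.upper_comp (f := fun q : (α × ℕ) × ℕ => q.1.1) (q := fun q => q.2)
      (by fun_prop) (by fun_prop)).and (SemiDec.codeReal_le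
        (g := fun q : (α × ℕ) × ℕ => q.1.2) (f := fun q => powCode q.2 (n q.1.1 + 1))
        (by fun_prop) (by fun_prop))).exists_code).of_iff fun p y => ?_
    simp only [codeReal_powCode]
    constructor
    · intro h
      obtain ⟨r, hr, hr'⟩ := exists_codeReal_gt
        (((continuous_pow (n p.1 + 1)).tendsto _).eventually (gt_mem_nhds h))
      exact ⟨r, hr, le_of_lt hr'⟩
    · rintro ⟨r, h1, h2⟩
      exact (pow_lt_pow_left₀ h1 (hF0 _ _) (Nat.succ_ne_zero _)).trans_le h2

/-- The number of summands varies with the parameter, so the search runs over lists of rational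
lower bounds, one for each summand. -/
theorem lower_sum {F : α × ℕ → Y → ℝ} (hF : RealComputable F) {n : α → ℕ} (hn : Computable n) :
    SemiDec fun (p : α × ℕ) y => codeReal p.2 < ∑ i ∈ Finset.range (n p.1), F (p.1, i) y := by
  refine ((((hF.lower_comp (f := fun q : ((α × ℕ) × List ℕ) × ℕ => (q.1.1.1, q.2))
    (q := fun q => q.1.2.getD q.2 0) (by fun_prop) (by fun_prop)).forall_lt
    (N := fun q : (α × ℕ) × List ℕ => n q.1.1) (by fun_prop)).and (SemiDec.codeReal_lt
      (f := fun q : (α × ℕ) × List ℕ => q.1.2) (g := fun q => sumCode q.2 (n q.1.1))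
      (by fun_prop) (by fun_prop))).exists_code).of_iff fun p y => ?_
  simp only [codeReal_sumCode]
  constructor
  · intro h
    set N := n p.1
    have hN : (0 : ℝ) < N + 1 := by positivity
    -- Dividing by N + 1 avoids a zero denominator and leaves slack δ after N losses of at most δ.
    set δ := (∑ i ∈ Finset.range N, F (p.1, i) y - codeReal p.2) / (N + 1) with hδ
    have hδ0 : 0 < δ := div_pos (sub_pos.2 h) hN
    obtain ⟨L, hL⟩ := exists_list_codeReal_between
      (fun i => sub_lt_self (F (p.1, i) y) hδ0) N
    refine ⟨L, fun i hi => (hL i hi).2, ?_⟩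
    have h1 : ∑ i ∈ Finset.range N, (F (p.1, i) y - δ) ≤
        ∑ i ∈ Finset.range N, codeReal (L.getD i 0) :=
      Finset.sum_le_sum fun i hi => (hL i (Finset.mem_range.1 hi)).1.le
    rw [Finset.sum_sub_distrib, Finset.sum_const, Finset.card_range, nsmul_eq_mul] at h1
    have h2 : δ * (N + 1) = ∑ i ∈ Finset.range N, F (p.1, i) y - codeReal p.2 := by
      rw [hδ]; field_simp
    linarith
  · rintro ⟨L, h1, h2⟩
    exact h2.trans_le (Finset.sum_le_sum fun i hi => (h1 i (Finset.mem_range.1 hi)).le)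

theorem sum {F : α × ℕ → Y → ℝ} (hF : RealComputable F) {n : α → ℕ} (hn : Computable n) :
    RealComputable fun a y => ∑ i ∈ Finset.range (n a), F (a, i) y :=
  of_lower (hF.lower_sum hn) ((hF.neg.lower_sum hn).of_iff fun p y => by
    rw [Finset.sum_neg_distrib])

theorem ite {b : α → Bool} (hb : Computable b) (hF : RealComputable F) (hG : RealComputable G) :
    RealComputable fun a y => if b a = true then F a y else G a y := by
  have hb1 : SemiDec fun (p : α × ℕ) (_ : Y) => b p.1 = true := SemiDec.of_bool (by fun_prop)
  have hb2 : SemiDec fun (p : α × ℕ) (_ : Y) => (!b p.1) = true := SemiDec.of_bool (by fun_prop)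
  exact ⟨((hb1.and hF.lower).or (hb2.and hG.lower)).of_iff fun p y => by cases b p.1 <;> simp,
    ((hb1.and hF.upper).or (hb2.and hG.upper)).of_iff fun p y => by cases b p.1 <;> simp⟩

/-- A family enclosed by two computable families that converge to it is computable. -/
theorem of_tendsto {L H : α × ℕ → Y → ℝ} (hL : RealComputable L) (hH : RealComputable H)
    (hLF : ∀ a y k, L (a, k) y ≤ F a y) (hFH : ∀ a y k, F a y ≤ H (a, k) y)
    (hL' : ∀ a y, Tendsto (fun k => L (a, k) y) atTop (𝓝 (F a y)))
    (hH' : ∀ a y, Tendsto (fun k => H (a, k) y) atTop (𝓝 (F a y))) : RealComputable F := by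
  constructor
  · refine ((hL.lower_comp (f := fun q : (α × ℕ) × ℕ => (q.1.1, q.2)) (q := fun q => q.1.2)
      (by fun_prop) (by fun_prop)).exists_code).of_iff fun p y => ⟨fun h => ?_, fun ⟨k, hk⟩ => ?_⟩
    · exact ((hL' p.1 y).eventually (lt_mem_nhds h)).exists
    · exact hk.trans_le (hLF _ _ _)
  · refine ((hH.upper_comp (f := fun q : (α × ℕ) × ℕ => (q.1.1, q.2)) (q := fun q => q.1.2)
      (by fun_prop) (by fun_prop)).exists_code).of_iff fun p y => ⟨fun h => ?_, fun ⟨k, hk⟩ => ?_⟩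
    · exact ((hH' p.1 y).eventually (gt_mem_nhds h)).exists
    · exact (hFH _ _ _).trans_lt hk

/-- The functions G - E and G + E enclose F and converge to it; no rate of convergence of E is
required. -/
theorem of_abs_sub_le {G E : α × ℕ → Y → ℝ} (hG : RealComputable G) (hE : RealComputable E)
    (h : ∀ a y k, |G (a, k) y - F a y| ≤ E (a, k) y)
    (hE' : ∀ a y, Tendsto (fun k => E (a, k) y) atTop (𝓝 0)) : RealComputable F := by
  have hG' : ∀ a y, Tendsto (fun k => G (a, k) y) atTop (𝓝 (F a y)) := fun a y =>
    tendsto_iff_dist_tendsto_zero.2 (squeeze_zero (fun _ => dist_nonneg)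
      (fun k => (Real.dist_eq _ _).trans_le (h a y k)) (hE' a y))
  refine of_tendsto (hG.sub hE) (hG.add hE) (fun a y k => ?_) (fun a y k => ?_)
    (fun a y => by simpa using (hG' a y).sub (hE' a y))
    (fun a y => by simpa using (hG' a y).add (hE' a y))
  · linarith [(abs_le.1 (h a y k)).2]
  · linarith [(abs_le.1 (h a y k)).1]

/-- A function is computable if it can be approximated from the entries of Cauchy names. -/
theorem of_name {G : α × ℕ → ℝ} (hG : RealComputable fun p (_ : ℕ) => G p) {s : α × ℕ → ℕ}
    (hs : Computable s) (h : ∀ y g, IsCauchyName g y → ∀ a j,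
      |G (a, g (s (a, j))) - F a y| ≤ (2 : ℝ)⁻¹ ^ j) : RealComputable F := by
  have ht : Tendsto (fun j : ℕ => (2 : ℝ)⁻¹ ^ j) atTop (𝓝 0) :=
    tendsto_pow_atTop_nhds_zero_of_lt_one (by norm_num) (by norm_num)
  have key : ∀ {K : α → Y → ℝ} {G : α × ℕ → ℝ}, RealComputable (fun p (_ : ℕ) => G p) →
      (∀ y g, IsCauchyName g y → ∀ a j, |G (a, g (s (a, j))) - K a y| ≤ (2 : ℝ)⁻¹ ^ j) →
      SemiDec fun (p : α × ℕ) y => codeReal p.2 < K p.1 y := by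
    intro K G hG h
    -- An entry of the name, with its index, witnesses the lower bound if that index is the one
    -- prescribed for some precision `j` and the approximation exceeds the bound by more than its
    -- error.
    have hsd : SemiDec fun (p : (α × ℕ) × ℕ × ℕ) (_ : ℕ) => ∃ j, s (p.1.1, j) = p.2.1 ∧
        codeReal p.1.2 < G (p.1.1, p.2.2) - (2 : ℝ)⁻¹ ^ j := by
      refine SemiDec.exists_code (R := fun (q : ((α × ℕ) × ℕ × ℕ) × ℕ) (_ : ℕ) =>
        s (q.1.1.1, q.2) = q.1.2.1 ∧
          codeReal q.1.1.2 < G (q.1.1.1, q.1.2.2) - (2 : ℝ)⁻¹ ^ q.2) (SemiDec.and ?_ ?_)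
      · exact (SemiDec.of_bool (b := fun q : ((α × ℕ) × ℕ × ℕ) × ℕ =>
          Nat.beq (s (q.1.1.1, q.2)) q.1.2.1) (by fun_prop)).of_iff fun _ _ => by simp
      · exact ((hG.comp (f := fun q : ((α × ℕ) × ℕ × ℕ) × ℕ => (q.1.1.1, q.1.2.2))
          (by fun_prop)).sub (halfPow (f := fun q => q.2) (by fun_prop))).lower_comp
          (f := fun q => q) (q := fun q => q.1.1.2) (by fun_prop) (by fun_prop)
    refine SemiDec.of_name hsd fun y g hg p => ?_
    constructor
    · intro hlt
      have hG' : Tendsto (fun j => G (p.1, g (s (p.1, j))) - (2 : ℝ)⁻¹ ^ j) atTop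
          (𝓝 (K p.1 y - 0)) :=
        (tendsto_iff_dist_tendsto_zero.2 (squeeze_zero (fun _ => dist_nonneg)
          (fun j => (Real.dist_eq _ _).trans_le (h y g hg p.1 j)) ht)).sub ht
      rw [sub_zero] at hG'
      obtain ⟨j, hj⟩ := (hG'.eventually (lt_mem_nhds hlt)).exists
      exact ⟨s (p.1, j), j, rfl, hj⟩
    · rintro ⟨m, j, hj, hlt⟩
      have := (abs_le.1 (h y g hg p.1 j)).2
      simp only at hj hlt
      rw [hj] at this
      linarith
  refine of_lower (key hG h) (key (K := fun a y => -F a y) (G := fun p => -G p) hG.neg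
    fun y g hg a j => ?_)
  rw [neg_sub_neg, abs_sub_comm]
  exact h y g hg a j

/-- For the n-th output, search for a rational verified to be within 2⁻⁽ⁿ⁺¹⁾ of the value; the
length of the segment codes the candidate and the length used to verify it. The extra factor 1/2
makes two outputs with indices i ≤ j differ by at most 2⁻ⁱ. The output sequence may depend on the
name, but its limit does not. -/
theorem computableMap {F : Y → ℝ} (hF : RealComputable fun (_ : Unit) y => F y) :
    ComputableMap F := by
  have happ : SemiDec fun (p : ℕ × ℕ) y => |codeReal p.2 - F y| < (2 : ℝ)⁻¹ ^ (p.1 + 1) := by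
    have h1 := ((code (f := fun p : ℕ × ℕ => p.2) (by fun_prop)).sub (hF.comp
      (f := fun _ : ℕ × ℕ => ()) (by fun_prop))).abs
    refine (h1.upper_comp (f := fun p : ℕ × ℕ => p) (q := fun p => halfPowCode (p.1 + 1))
      (by fun_prop) (by fun_prop)).of_iff fun _ _ => by simp
  obtain ⟨D, hD, h⟩ := happ
  refine ⟨fun q => bif D ((q.2, q.1.length.unpair.1), q.1.take q.1.length.unpair.2)
    then some q.1.length.unpair.1 else none, by fun_prop, fun y g hg => ?_⟩
  have hdom : ∀ n, (functional (fun q => bif D ((q.2, q.1.length.unpair.1),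
      q.1.take q.1.length.unpair.2) then some q.1.length.unpair.1 else none) g n).Dom := by
    intro n
    obtain ⟨c, -, hc⟩ := exists_codeReal_gt (x := F y)
      (s := {c | |c - F y| < (2 : ℝ)⁻¹ ^ (n + 1)})
      (Metric.ball_mem_nhds (F y) (by positivity))
    obtain ⟨k, hk⟩ := (h y g hg (n, c)).1 hc
    refine Nat.rfindOpt_dom.2 ⟨Nat.pair c k, c, ?_⟩
    have := initSeg_take g (Nat.right_le_pair c k)
    simp only [initSeg] at this hk
    simp [this, hk]
  choose r hr using fun n => Part.dom_iff_mem.1 (hdom n)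
  refine ⟨r, hr, ?_⟩
  have hlt : ∀ n, |codeReal (r n) - F y| < (2 : ℝ)⁻¹ ^ (n + 1) := by
    intro n
    obtain ⟨k, hk⟩ := Nat.rfindOpt_spec (hr n)
    change (bif D ((n, (initSeg g k).length.unpair.1),
      (initSeg g k).take (initSeg g k).length.unpair.2)
      then some (initSeg g k).length.unpair.1 else none) = some (r n) at hk
    rw [initSeg_length, initSeg_take g (Nat.unpair_right_le _)] at hk
    cases hd : D ((n, k.unpair.1), initSeg g k.unpair.2)
    · simp [hd] at hk
    · simp only [hd, cond_true, Option.some.injEq] at hk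
      rw [← hk]
      exact (h y g hg (n, k.unpair.1)).2 ⟨_, hd⟩
  refine ⟨fun i j hij => ?_, ?_⟩
  · change dist (codeReal (r j)) (codeReal (r i)) ≤ _
    have h1 := hlt i
    have h2 := hlt j
    have h3 : (2 : ℝ)⁻¹ ^ (j + 1) ≤ (2 : ℝ)⁻¹ ^ (i + 1) :=
      pow_le_pow_of_le_one (by norm_num) (by norm_num) (by omega)
    have h4 : (2 : ℝ)⁻¹ ^ i = (2 : ℝ)⁻¹ ^ (i + 1) + (2 : ℝ)⁻¹ ^ (i + 1) := by ring
    refine (dist_triangle_right _ _ (F y)).trans ?_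
    rw [Real.dist_eq, Real.dist_eq]
    linarith
  · change Tendsto (fun i => codeReal (r i)) atTop (𝓝 (F y))
    refine tendsto_iff_dist_tendsto_zero.2 (squeeze_zero (fun _ => dist_nonneg)
      (fun j => (Real.dist_eq _ _).trans_le (hlt j).le) ?_)
    exact (tendsto_pow_atTop_nhds_zero_of_lt_one (by norm_num) (by norm_num)).comp
      (tendsto_add_atTop_nat 1)

end RealComputable

/-! ### Names of pairs and of natural numbers -/

theorem IsCauchyName.dist_le {h : ℕ → ℕ} {y : Y} (hh : IsCauchyName h y) (i : ℕ) :
    dist (BasicPoints.basicPt (h i) : Y) y ≤ (2 : ℝ)⁻¹ ^ i := by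
  rw [dist_comm]
  exact le_of_tendsto (hh.2.dist tendsto_const_nhds)
    (eventually_atTop.2 ⟨i, fun j hj => hh.1 i j hj⟩)

theorem IsCauchyName.fst {h : ℕ → ℕ} {z : Y × Z} (hh : IsCauchyName h z) :
    IsCauchyName ((fun n => n.unpair.1) ∘ h) z.1 :=
  ⟨fun i j hij => (le_max_left _ _).trans (hh.1 i j hij),
    (continuous_fst.tendsto z).comp hh.2⟩

theorem IsCauchyName.snd {h : ℕ → ℕ} {z : Y × Z} (hh : IsCauchyName h z) :
    IsCauchyName ((fun n => n.unpair.2) ∘ h) z.2 :=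
  ⟨fun i j hij => (le_max_right _ _).trans (hh.1 i j hij),
    (continuous_snd.tendsto z).comp hh.2⟩

/-- Entry 1 is within 1/2 of the limit, less than the distance of distinct naturals; the bound 1 for
entry 0 would not suffice. -/
theorem IsCauchyName.nat_eq {h : ℕ → ℕ} {n : ℕ} (hh : IsCauchyName h n) : h 1 = n := by
  have h1 := hh.dist_le 1
  change dist (h 1 : ℕ) n ≤ _ at h1
  by_contra hne
  have : (1 : ℝ) ≤ dist (h 1) n := by
    rw [Nat.dist_eq]
    exact_mod_cast Int.one_le_abs (sub_ne_zero.2 (Int.ofNat_inj.not.2 hne))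
  norm_num at h1
  linarith

/-- A natural number given by a name can be read off exactly from entry 1, so it may be moved from
the point to the parameter. Segments shorter than 2 are rejected because this entry is missing. -/
theorem SemiDec.uncurry_nat {W : ℕ × β → Y → Prop} (hW : SemiDec W) :
    SemiDec fun b (z : ℕ × Y) => W (z.1, b) z.2 := by
  obtain ⟨D, hD, hm, h⟩ := (hW.comp_point (Z := ℕ × Y) (π := Prod.snd)
    (Primrec.snd.comp Primrec.unpair) fun _ _ h => h.snd).exists_monotone
  refine ⟨fun p => Nat.ble 2 p.2.length && D (((p.2.getD 1 0).unpair.1, p.1), p.2),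
    by fun_prop, fun z g hg b => ?_⟩
  have hz : (g 1).unpair.1 = z.1 := hg.fst.nat_eq
  simp only [Bool.and_eq_true, Nat.ble_eq, initSeg_length, h z g hg]
  constructor
  · rintro ⟨k, hk⟩
    refine ⟨max k 2, le_max_right _ _, ?_⟩
    rw [initSeg_getD g (Nat.lt_of_succ_le (le_max_right k 2)), hz]
    exact hm _ _ _ _ (le_max_left _ _) hk
  · rintro ⟨k, h2, hk⟩
    rw [initSeg_getD g h2, hz] at hk
    exact ⟨k, hk⟩

namespace RealComputable

variable {F : α → Y → ℝ}

theorem comp_fst (hF : RealComputable F) : RealComputable fun a (z : Y × Z) => F a z.1 :=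
  hF.comp_point (Primrec.fst.comp Primrec.unpair) fun _ _ h => h.fst

theorem comp_snd (hF : RealComputable F) : RealComputable fun a (z : Z × Y) => F a z.2 :=
  hF.comp_point (Primrec.snd.comp Primrec.unpair) fun _ _ h => h.snd

theorem computableMap_nat {F : ℕ → Y → ℝ} (hF : RealComputable F) :
    ComputableMap fun z : ℕ × Y => F z.1 z.2 :=
  computableMap ⟨hF.lower.uncurry_nat.comp (f := fun p : Unit × ℕ => p.2) (by fun_prop),
    hF.upper.uncurry_nat.comp (f := fun p : Unit × ℕ => p.2) (by fun_prop)⟩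

end RealComputable

/-! ## Distances from basic points -/

section Distance

variable {X : Type*} [ComputableMetricSpace X]

theorem exists_computable_dist (X : Type*) [ComputableMetricSpace X] :
    ∃ g : (ℕ × ℕ) × ℕ → ℕ, Computable g ∧ ∀ i j k,
      |codeReal (g ((i, j), k)) - dist (BasicPoints.basicPt i : X) (BasicPoints.basicPt j)| ≤
        (2 : ℝ)⁻¹ ^ k := by
  obtain ⟨g, hg, h⟩ := ComputableMetricSpace.computable_dist (X := X)
  exact ⟨fun p => g p.1 p.2, hg, fun i j k => (h i j).dist_le k⟩

theorem tendsto_half_pow : Tendsto (fun j : ℕ => (2 : ℝ)⁻¹ ^ j) atTop (𝓝 0) :=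
  tendsto_pow_atTop_nhds_zero_of_lt_one (by norm_num) (by norm_num)

theorem RealComputable.dist_basicPt_basicPt : RealComputable fun (p : ℕ × ℕ) (_ : Y) =>
    dist (BasicPoints.basicPt p.1 : X) (BasicPoints.basicPt p.2) := by
  obtain ⟨g, hg, h⟩ := exists_computable_dist X
  exact RealComputable.of_abs_sub_le (.code hg) (.halfPow (f := fun p => p.2) (by fun_prop))
    (fun a _ k => h a.1 a.2 k) fun _ _ => tendsto_half_pow

theorem RealComputable.dist_basicPt :
    RealComputable fun (i : ℕ) (x : X) => dist (BasicPoints.basicPt i) x := by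
  refine RealComputable.of_name (RealComputable.dist_basicPt_basicPt (X := X)) (s := fun p => p.2)
    (by fun_prop) fun y g hg i j => ?_
  rw [abs_sub_comm, ← Real.dist_eq]
  refine (dist_dist_dist_le_right _ _ _).trans ?_
  rw [dist_comm]
  exact hg.dist_le j

end Distance

/-! ## Evaluation of basic functions at basic points -/

namespace BasicExpr

theorem ofNat_zero : ofNat 0 = .one := by rw [ofNat]

theorem ofNat_succ_bump {n : ℕ} (h : n % 4 = 0) : ofNat (n + 1) =
    .bump (n / 4).unpair.1 (n / 4).unpair.2.unpair.1 (n / 4).unpair.2.unpair.2 := by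
  rw [ofNat, h]; rfl

theorem ofNat_succ_sup {n : ℕ} (h : n % 4 = 1) : ofNat (n + 1) =
    .sup (ofNat (n / 4).unpair.1) (ofNat (n / 4).unpair.2) := by
  rw [ofNat, h]; rfl

theorem ofNat_succ_inf {n : ℕ} (h : n % 4 = 2) : ofNat (n + 1) =
    .inf (ofNat (n / 4).unpair.1) (ofNat (n / 4).unpair.2) := by
  rw [ofNat, h]; rfl

theorem ofNat_succ_comb {n : ℕ} (h : n % 4 = 3) : ofNat (n + 1) =
    .comb (n / 4).unpair.1.unpair.1 (n / 4).unpair.1.unpair.2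
      (ofNat (n / 4).unpair.2.unpair.1) (ofNat (n / 4).unpair.2.unpair.2) := by
  rw [ofNat, h]; rfl

/-- The value, up to an error, of the basic function with number `l.length`, and a bound for the
factor by which errors in distances are enlarged; `l` contains these data for the smaller numbers
and `d` approximate distances from the basic points. -/
def step (d : ℕ → ℕ) (l : List (ℕ × ℕ)) : ℕ × ℕ :=
  let n := l.length - 1
  let u := (n / 4).unpair
  -- In the lists built by `stepList` the default is never used: subexpressions have smaller
  -- numbers.
  let get : ℕ → ℕ × ℕ := fun j => l.getD j (0, 0)
  bif Nat.beq l.length 0 then (natCode 1, 0)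
  else bif Nat.beq (n % 4) 0 then
    (maxCode (natCode 0) (minCode (natCode 1)
      (mulCode (addCode (addCode (posCode u.2.unpair.1) (posCode u.2.unpair.2)) (negCode (d u.1)))
        (invPosCode u.2.unpair.2))), u.2.unpair.2.unpair.2 + 1)
  else bif Nat.beq (n % 4) 1 then
    (maxCode (get u.1).1 (get u.2).1, (get u.1).2 + (get u.2).2)
  else bif Nat.beq (n % 4) 2 then
    (minCode (get u.1).1 (get u.2).1, (get u.1).2 + (get u.2).2)
  else
    (addCode (mulCode u.1.unpair.1 (get u.2.unpair.1).1)
        (mulCode u.1.unpair.2 (get u.2.unpair.2).1),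
      (u.1.unpair.1.unpair.1.unpair.1 + u.1.unpair.1.unpair.1.unpair.2) * (get u.2.unpair.1).2 +
        (u.1.unpair.2.unpair.1.unpair.1 + u.1.unpair.2.unpair.1.unpair.2) *
          (get u.2.unpair.2).2)

/-- Course-of-values recursion: `ofNat` descends to arbitrary smaller numbers, so all earlier values
are kept. -/
def stepList (d : ℕ → ℕ) (n : ℕ) : List (ℕ × ℕ) :=
  Nat.rec [] (fun _ l => l ++ [step d l]) n

def approx (d : ℕ → ℕ) (n : ℕ) : ℕ × ℕ := step d (stepList d n)

theorem stepList_eq (d : ℕ → ℕ) (n : ℕ) : stepList d n = (List.range n).map (approx d) := by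
  induction n with
  | zero => rfl
  | succ n ih => rw [List.range_succ, List.map_append, ← ih]; rfl

theorem approx_eq (d : ℕ → ℕ) (n : ℕ) : approx d n = step d ((List.range n).map (approx d)) := by
  rw [approx, stepList_eq]

theorem getD_approx (d : ℕ → ℕ) {j n : ℕ} (h : j < n) :
    ((List.range n).map (approx d)).getD j (0, 0) = approx d j := by
  simp [h]

theorem approx_zero (d : ℕ → ℕ) : approx d 0 = (natCode 1, 0) := rfl

theorem approx_bump (d : ℕ → ℕ) {n : ℕ} (h : n % 4 = 0) : approx d (n + 1) =
    (maxCode (natCode 0) (minCode (natCode 1)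
      (mulCode (addCode (addCode (posCode (n / 4).unpair.2.unpair.1)
        (posCode (n / 4).unpair.2.unpair.2)) (negCode (d (n / 4).unpair.1)))
        (invPosCode (n / 4).unpair.2.unpair.2))), (n / 4).unpair.2.unpair.2.unpair.2 + 1) := by
  rw [approx_eq, step]
  simp only [List.length_map, List.length_range, Nat.add_sub_cancel, h]
  rfl

theorem fst_lt (n : ℕ) : (n / 4).unpair.1 < n + 1 :=
  (Nat.unpair_left_le _).trans_lt (by omega)

theorem snd_lt (n : ℕ) : (n / 4).unpair.2 < n + 1 :=
  (Nat.unpair_right_le _).trans_lt (by omega)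

theorem approx_sup (d : ℕ → ℕ) {n : ℕ} (h : n % 4 = 1) : approx d (n + 1) =
    (maxCode (approx d (n / 4).unpair.1).1 (approx d (n / 4).unpair.2).1,
      (approx d (n / 4).unpair.1).2 + (approx d (n / 4).unpair.2).2) := by
  rw [approx_eq, step]
  simp only [getD_approx d (fst_lt n), getD_approx d (snd_lt n), List.length_map, List.length_range,
    Nat.add_sub_cancel, h]
  rfl

theorem approx_inf (d : ℕ → ℕ) {n : ℕ} (h : n % 4 = 2) : approx d (n + 1) =
    (minCode (approx d (n / 4).unpair.1).1 (approx d (n / 4).unpair.2).1,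
      (approx d (n / 4).unpair.1).2 + (approx d (n / 4).unpair.2).2) := by
  rw [approx_eq, step]
  simp only [getD_approx d (fst_lt n), getD_approx d (snd_lt n), List.length_map, List.length_range,
    Nat.add_sub_cancel, h]
  rfl

/-- A bound for the absolute value of the rational with code `c`. -/
def absBound (c : ℕ) : ℕ := c.unpair.1.unpair.1 + c.unpair.1.unpair.2

theorem abs_codeReal_le (c : ℕ) : |codeReal c| ≤ absBound c := by
  have h : (0 : ℝ) < c.unpair.2 + 1 := by positivity
  rw [codeReal_eq, abs_div, abs_of_pos h, div_le_iff₀ h, absBound]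
  push_cast
  have h1 : (0 : ℝ) ≤ c.unpair.1.unpair.1 := by positivity
  have h2 : (0 : ℝ) ≤ c.unpair.1.unpair.2 := by positivity
  have h3 : (0 : ℝ) ≤ c.unpair.2 := by positivity
  rw [abs_le]
  constructor <;> nlinarith [mul_nonneg (add_nonneg h1 h2) h3]

theorem approx_comb (d : ℕ → ℕ) {n : ℕ} (h : n % 4 = 3) : approx d (n + 1) =
    (addCode
      (mulCode (n / 4).unpair.1.unpair.1 (approx d (n / 4).unpair.2.unpair.1).1)
      (mulCode (n / 4).unpair.1.unpair.2 (approx d (n / 4).unpair.2.unpair.2).1),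
      absBound (n / 4).unpair.1.unpair.1 * (approx d (n / 4).unpair.2.unpair.1).2 +
        absBound (n / 4).unpair.1.unpair.2 * (approx d (n / 4).unpair.2.unpair.2).2) := by
  rw [approx_eq, step]
  simp only [getD_approx d ((Nat.unpair_left_le _).trans_lt (snd_lt n)),
    getD_approx d ((Nat.unpair_right_le _).trans_lt (snd_lt n)), List.length_map,
    List.length_range, Nat.add_sub_cancel, h]
  rfl

theorem computable_approx {d : α × ℕ → ℕ} (hd : Computable d) {n : α → ℕ} (hn : Computable n) :
    Computable fun a => approx (fun c => d (a, c)) (n a) := by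
  have hstep : Computable fun q : α × List (ℕ × ℕ) => step (fun c => d (q.1, c)) q.2 := by
    unfold step
    dsimp only
    fun_prop
  have hlist : Computable fun a => stepList (fun c => d (a, c)) (n a) :=
    Computable.natRec hn (Computable.const [])
      (g := fun q => q.2.2 ++ [step (fun c => d (q.1, c)) q.2.2])
      (Computable.list_concat.comp (by fun_prop)
        (hstep.comp (g := fun q : α × ℕ × List (ℕ × ℕ) => (q.1, q.2.2)) (by fun_prop)))
  exact hstep.comp (g := fun a => (a, stepList (fun c => d (a, c)) (n a))) (by fun_prop)

theorem mod_four_cases (n : ℕ) : n % 4 = 0 ∨ n % 4 = 1 ∨ n % 4 = 2 ∨ n % 4 = 3 := by omega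

/-- The error factor depends on the expression alone. It therefore stays fixed while the precision
of the distances increases, and the error tends to 0. -/
theorem approx_snd (d d' : ℕ → ℕ) (n : ℕ) : (approx d n).2 = (approx d' n).2 := by
  induction n using Nat.strong_induction_on with
  | _ n ih =>
    cases n with
    | zero => rw [approx_zero, approx_zero]
    | succ n =>
      rcases mod_four_cases n with h | h | h | h
      · rw [approx_bump d h, approx_bump d' h]
      · rw [approx_sup d h, approx_sup d' h, ih _ (fst_lt n), ih _ (snd_lt n)]
      · rw [approx_inf d h, approx_inf d' h, ih _ (fst_lt n), ih _ (snd_lt n)]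
      · rw [approx_comb d h, approx_comb d' h, ih _ ((Nat.unpair_left_le _).trans_lt (snd_lt n)),
          ih _ ((Nat.unpair_right_le _).trans_lt (snd_lt n))]

theorem abs_bump_sub_le (u v : ℝ) : |max 0 (min 1 u) - max 0 (min 1 v)| ≤ |u - v| := by
  refine (abs_max_sub_max_le_max _ _ _ _).trans ?_
  rw [sub_self, abs_zero, max_eq_right (abs_nonneg _)]
  refine (abs_min_sub_min_le_max _ _ _ _).trans ?_
  rw [sub_self, abs_zero, max_eq_right (abs_nonneg _)]

theorem inv_posRat_le (n : ℕ) : (posRat n : ℝ)⁻¹ ≤ n.unpair.2 + 1 := by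
  rw [← codeReal_invPosCode, invPosCode, codeReal_mkCode]
  push_cast
  rw [sub_zero]
  exact div_le_self (by positivity) (by linarith [Nat.cast_nonneg (α := ℝ) n.unpair.1])

/-- Errors propagate through the expression: clipping does not enlarge them, the slope of a bump
multiplies them by the inverse of its width, maxima and minima take at most the larger one, and
linear combinations scale them by the coefficients. -/
theorem abs_approx_sub_le {X : Type*} [PseudoMetricSpace X] [BasicPoints X] {d : ℕ → ℕ} {x : X}
    {δ : ℝ} (hd : ∀ c, |codeReal (d c) - dist (BasicPoints.basicPt c) x| ≤ δ) (n : ℕ) :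
    |codeReal (approx d n).1 - (ofNat n).eval x| ≤ (approx d n).2 * δ := by
  have hδ : 0 ≤ δ := (abs_nonneg _).trans (hd 0)
  induction n using Nat.strong_induction_on with
  | _ n ih =>
    cases n with
    | zero => simp [approx_zero, ofNat_zero, eval]
    | succ n =>
      have ih1 := ih _ (fst_lt n)
      have ih2 := ih _ (snd_lt n)
      have hle : ∀ {u v : ℝ} {a b : ℕ}, u ≤ a * δ → v ≤ b * δ → max u v ≤ (a + b : ℕ) * δ := by
        intro u v a b hu hv
        push_cast
        have := mul_nonneg (Nat.cast_nonneg (α := ℝ) a) hδ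
        have := mul_nonneg (Nat.cast_nonneg (α := ℝ) b) hδ
        exact max_le (by linarith) (by linarith)
      rcases mod_four_cases n with h | h | h | h
      · rw [approx_bump d h, ofNat_succ_bump h]
        simp only [codeReal_maxCode, codeReal_minCode, codeReal_natCode, codeReal_mulCode,
          codeReal_addCode, codeReal_posCode, codeReal_negCode, codeReal_invPosCode, eval, bumpFun,
          Nat.cast_zero, Nat.cast_one, add_sub_cancel_left]
        refine (abs_bump_sub_le _ _).trans ?_
        rw [div_eq_mul_inv, ← sub_mul, abs_mul, abs_of_pos (inv_pos.2 (posRat_pos _)), mul_comm]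
        refine mul_le_mul ?_ ?_ (abs_nonneg _) (by positivity)
        · push_cast
          exact inv_posRat_le _
        · rw [← sub_eq_add_neg, sub_sub_sub_cancel_left, abs_sub_comm]
          exact hd _
      · rw [approx_sup d h, ofNat_succ_sup h, codeReal_maxCode]
        exact (abs_max_sub_max_le_max _ _ _ _).trans (hle ih1 ih2)
      · rw [approx_inf d h, ofNat_succ_inf h, codeReal_minCode]
        exact (abs_min_sub_min_le_max _ _ _ _).trans (hle ih1 ih2)
      · have ih3 := ih _ ((Nat.unpair_left_le _).trans_lt (snd_lt n))
        have ih4 := ih _ ((Nat.unpair_right_le _).trans_lt (snd_lt n))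
        rw [approx_comb d h, ofNat_succ_comb h, codeReal_addCode, codeReal_mulCode,
          codeReal_mulCode]
        set p := (n / 4).unpair.1.unpair.1
        set q := (n / 4).unpair.1.unpair.2
        simp only [eval]
        change |codeReal p * _ + codeReal q * _ - (codeReal p * _ + codeReal q * _)| ≤ _
        rw [add_sub_add_comm, ← mul_sub, ← mul_sub]
        refine (abs_add_le _ _).trans ?_
        rw [abs_mul, abs_mul]
        push_cast
        rw [add_mul, mul_assoc, mul_assoc]
        exact add_le_add
          (mul_le_mul (abs_codeReal_le p) ih3 (abs_nonneg _) (Nat.cast_nonneg _))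
          (mul_le_mul (abs_codeReal_le q) ih4 (abs_nonneg _) (Nat.cast_nonneg _))

theorem realComputable_eval_basicPt {X : Type*} [ComputableMetricSpace X] :
    RealComputable fun (p : ℕ × ℕ) (_ : Y) => (ofNat p.1).eval (BasicPoints.basicPt p.2 : X) := by
  obtain ⟨g, hg, h⟩ := exists_computable_dist X
  have hc : Computable fun p : (ℕ × ℕ) × ℕ =>
      approx (fun c => g ((c, p.1.2), p.2)) p.1.1 :=
    computable_approx (d := fun q : ((ℕ × ℕ) × ℕ) × ℕ => g ((q.2, q.1.1.2), q.1.2)) (by fun_prop)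
      (by fun_prop)
  refine RealComputable.of_abs_sub_le
    (RealComputable.code (f := fun p : (ℕ × ℕ) × ℕ =>
      (approx (fun c => g ((c, p.1.2), p.2)) p.1.1).1) (by fun_prop))
    ((RealComputable.natCast (f := fun p : (ℕ × ℕ) × ℕ =>
      (approx (fun c => g ((c, p.1.2), p.2)) p.1.1).2) (by fun_prop)).mul
      (.halfPow (f := fun p => p.2) (by fun_prop)))
    (fun a _ k => abs_approx_sub_le (fun c => h c a.2 k) a.1) fun a _ => ?_
  simp only [fun k => approx_snd (fun c => g ((c, a.2), k)) (fun _ => 0) a.1]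
  simpa using tendsto_half_pow.const_mul _

end BasicExpr

/-! ## Integrals of basic functions -/

theorem BasicExpr.exists_abs_eval_le {X : Type*} [PseudoMetricSpace X] [BasicPoints X]
    (e : BasicExpr) : ∃ C : ℝ, ∀ x : X, |e.eval x| ≤ C := by
  induction e with
  | one => exact ⟨1, fun x => by simp [eval]⟩
  | bump i r s =>
    refine ⟨1, fun x => ?_⟩
    simp only [eval, bumpFun]
    rw [abs_of_nonneg (le_max_left _ _)]
    exact max_le zero_le_one (min_le_left _ _)
  | sup e f he hf =>
    obtain ⟨C, hC⟩ := he
    obtain ⟨D, hD⟩ := hf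
    exact ⟨max C D, fun x => abs_max_le_max_abs_abs.trans (max_le_max (hC x) (hD x))⟩
  | inf e f he hf =>
    obtain ⟨C, hC⟩ := he
    obtain ⟨D, hD⟩ := hf
    exact ⟨max C D, fun x => abs_min_le_max_abs_abs.trans (max_le_max (hC x) (hD x))⟩
  | comb p q e f he hf =>
    obtain ⟨C, hC⟩ := he
    obtain ⟨D, hD⟩ := hf
    refine ⟨|(ratOfCode p : ℝ)| * C + |(ratOfCode q : ℝ)| * D, fun x => ?_⟩
    simp only [eval]
    refine (abs_add_le _ _).trans ?_
    rw [abs_mul, abs_mul]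
    exact add_le_add (mul_le_mul_of_nonneg_left (hC x) (abs_nonneg _))
      (mul_le_mul_of_nonneg_left (hD x) (abs_nonneg _))

section Measure

variable {X : Type*} [ComputableMetricSpace X] [MeasurableSpace X] [BorelSpace X]

theorem BasicExpr.integrable_eval (e : BasicExpr) (ν : Measure X) [IsFiniteMeasure ν] :
    Integrable (fun x => e.eval x) ν := by
  obtain ⟨C, hC⟩ := e.exists_abs_eval_le (X := X)
  exact Integrable.of_bound e.continuous_eval.measurable.aestronglyMeasurable C
    (Eventually.of_forall hC)

theorem integral_basicAtom (e : BasicExpr) (k : ℕ) :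
    ∫ x, e.eval x ∂(basicAtom X k : Measure X) =
      posRat k.unpair.1 * e.eval (BasicPoints.basicPt k.unpair.2 : X) := by
  have : ((basicAtom X k : FiniteMeasure X) : Measure X) =
      (posRat k.unpair.1 : NNReal) • Measure.dirac (BasicPoints.basicPt k.unpair.2) := rfl
  rw [this, integral_smul_nnreal_measure, integral_dirac' _ _
    e.continuous_eval.measurable.stronglyMeasurable]
  rfl

theorem integral_basicAtom_sum (e : BasicExpr) (l : List ℕ) :
    ∫ x, e.eval x ∂(((l.map (basicAtom X)).sum : FiniteMeasure X) : Measure X) =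
      ∑ j ∈ Finset.range l.length, ∫ x, e.eval x ∂(basicAtom X (l.getD j 0) : Measure X) := by
  induction l with
  | nil => simp
  | cons k l ih =>
    rw [List.map_cons, List.sum_cons, FiniteMeasure.toMeasure_add,
      integral_add_measure (e.integrable_eval _) (e.integrable_eval _), ih, List.length_cons,
      Finset.sum_range_succ']
    simp only [List.getD_cons_succ, List.getD_cons_zero]
    rw [add_comm]

theorem basicIntegral_basicPt (i n : ℕ) :
    basicIntegral i (BasicPoints.basicPt n : FinMeas X) =
      posRat n.unpair.1.unpair.1 *
          (BasicExpr.ofNat i).eval (BasicPoints.basicPt n.unpair.1.unpair.2 : X) +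
        ∑ j ∈ Finset.range (Denumerable.ofNat (List ℕ) n.unpair.2).length,
          posRat ((Denumerable.ofNat (List ℕ) n.unpair.2).getD j 0).unpair.1 *
          (BasicExpr.ofNat i).eval (BasicPoints.basicPt
            ((Denumerable.ofNat (List ℕ) n.unpair.2).getD j 0).unpair.2 : X) := by
  have h : (BasicPoints.basicPt n : FinMeas X).toMeasure =
      ((basicAtom X n.unpair.1 + ((Denumerable.ofNat (List ℕ) n.unpair.2).map
        (basicAtom X)).sum : FiniteMeasure X) : Measure X) := rfl
  rw [basicIntegral, h, FiniteMeasure.toMeasure_add,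
    integral_add_measure (BasicExpr.integrable_eval _ _) (BasicExpr.integrable_eval _ _),
    integral_basicAtom_sum, integral_basicAtom]
  simp only [integral_basicAtom]

theorem RealComputable.basicIntegral_basicPt : RealComputable fun (p : ℕ × ℕ) (_ : Y) =>
    basicIntegral p.1 (BasicPoints.basicPt p.2 : FinMeas X) := by
  have hev := BasicExpr.realComputable_eval_basicPt (X := X) (Y := Y)
  have h1 := (RealComputable.posRat (Y := Y) (f := fun p : ℕ × ℕ => p.2.unpair.1.unpair.1)
    (by fun_prop)).mul (hev.comp (f := fun p : ℕ × ℕ => (p.1, p.2.unpair.1.unpair.2)) (by fun_prop))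
  have h2 := ((RealComputable.posRat (Y := Y) (f := fun p : (ℕ × ℕ) × ℕ =>
    ((Denumerable.ofNat (List ℕ) p.1.2.unpair.2).getD p.2 0).unpair.1)
    (by fun_prop)).mul (hev.comp (f := fun p : (ℕ × ℕ) × ℕ => (p.1.1,
      ((Denumerable.ofNat (List ℕ) p.1.2.unpair.2).getD p.2 0).unpair.2)) (by fun_prop))).sum
    (n := fun p => (Denumerable.ofNat (List ℕ) p.2.unpair.2).length) (by fun_prop)
  exact (h1.add h2).of_eq fun p _ => _root_.basicIntegral_basicPt p.1 p.2

/-- A single term of the series is bounded by the distance, so with u = 2⁻ʲ one gets 1 - exp(-x) ≤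
u/2. Hence x ≤ -log(1 - u/2) ≤ (1 - u/2)⁻¹ - 1 ≤ u, the last step because u ≤ 1. Thus a name of μ
gives each integral with a known precision. -/
theorem abs_basicIntegral_sub_le (μ ν : FinMeas X) (i j : ℕ)
    (h : dist μ ν ≤ (2 : ℝ)⁻¹ ^ (i + j + 1)) :
    |basicIntegral i μ - basicIntegral i ν| ≤ (2 : ℝ)⁻¹ ^ j := by
  set x := |basicIntegral i μ - basicIntegral i ν| with hx
  have hterm : (2 : ℝ)⁻¹ ^ i * (1 - Real.exp (-x)) ≤ (2 : ℝ)⁻¹ ^ (i + j + 1) :=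
    ((measDist_summable μ ν).le_tsum i fun k _ => measDist_term_nonneg μ ν k).trans h
  have hi : (0 : ℝ) < (2 : ℝ)⁻¹ ^ i := by positivity
  have hj : (0 : ℝ) < (2 : ℝ)⁻¹ ^ j := by positivity
  have hj1 : (2 : ℝ)⁻¹ ^ j ≤ 1 := pow_le_one₀ (by norm_num) (by norm_num)
  rw [add_assoc, pow_add] at hterm
  have h1 : 1 - Real.exp (-x) ≤ (2 : ℝ)⁻¹ ^ (j + 1) := le_of_mul_le_mul_left hterm hi
  rw [pow_succ] at h1
  set u := (2 : ℝ)⁻¹ ^ j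
  have hpos : 0 < 1 - u * 2⁻¹ := by linarith
  have h2 : Real.log (1 - u * 2⁻¹) ≤ -x := by
    rw [← Real.log_exp (-x)]
    exact Real.log_le_log hpos (by linarith)
  have h3 := Real.one_sub_inv_le_log_of_pos hpos
  have h4 : (1 - u * 2⁻¹)⁻¹ ≤ 1 + u := by
    rw [inv_le_iff_one_le_mul₀ hpos]
    nlinarith
  linarith

theorem RealComputable.basicIntegral :
    RealComputable fun (i : ℕ) (μ : FinMeas X) => basicIntegral i μ := by
  refine RealComputable.of_name (RealComputable.comp (RealComputable.basicIntegral_basicPt (X := X))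
    (f := fun p : ℕ × ℕ => (p.1, p.2)) (by fun_prop)) (s := fun p => p.1 + p.2 + 1)
    (by fun_prop) fun μ g hg i j => ?_
  exact abs_basicIntegral_sub_le _ _ i j (hg.dist_le _)

/-! ## The distance between measures -/

/-- Rational expressions in the integrals of basic functions that approximate the distance of
measures from above. -/
def distBound (N K : ℕ) (μ ν : FinMeas X) : ℝ :=
  ∑ i ∈ Finset.range N, (2 : ℝ)⁻¹ ^ i *
      (1 - (max 0 (1 - |basicIntegral i μ - basicIntegral i ν| * ((K : ℝ) + 1)⁻¹)) ^ (K + 1)) +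
    2 * (2 : ℝ)⁻¹ ^ N

/-- Powers stand in for the exponential, so that only rational arithmetic is needed. They lie below
it, which makes `distBound` an upper bound; the maximum with 0 keeps the base nonnegative. -/
theorem max_pow_le_exp_neg {x : ℝ} (K : ℕ) :
    (max 0 (1 - x * ((K : ℝ) + 1)⁻¹)) ^ (K + 1) ≤ Real.exp (-x) := by
  have hK : (0 : ℝ) < (K : ℝ) + 1 := by positivity
  have h : max 0 (1 - x * ((K : ℝ) + 1)⁻¹) ≤ Real.exp (-(x * ((K : ℝ) + 1)⁻¹)) :=
    max_le (Real.exp_pos _).le (Real.one_sub_le_exp_neg _)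
  refine (pow_le_pow_left₀ (le_max_left _ _) h _).trans_eq ?_
  rw [← Real.exp_nat_mul]
  congr 1
  push_cast
  field_simp

theorem tendsto_max_pow (x : ℝ) : Tendsto (fun K : ℕ =>
    (max 0 (1 - x * ((K : ℝ) + 1)⁻¹)) ^ (K + 1)) atTop (𝓝 (Real.exp (-x))) := by
  have h := (Real.tendsto_one_add_div_pow_exp (-x)).comp (tendsto_add_atTop_nat 1)
  refine h.congr' ?_
  -- From here on the base is nonnegative and the maximum with 0 has no effect.
  obtain ⟨M, hM⟩ := exists_nat_ge x
  filter_upwards [eventually_ge_atTop M] with K hK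
  have hK0 : (0 : ℝ) < (K : ℝ) + 1 := by positivity
  have : x * ((K : ℝ) + 1)⁻¹ ≤ 1 := by
    rw [← div_eq_mul_inv, div_le_one hK0]
    have : (M : ℝ) ≤ K := by exact_mod_cast hK
    linarith
  rw [max_eq_right (by linarith)]
  simp only [Function.comp]
  push_cast
  congr 1
  rw [neg_div, div_eq_mul_inv]
  ring

theorem dist_le_distBound (N K : ℕ) (μ ν : FinMeas X) : dist μ ν ≤ distBound N K μ ν := by
  change measDist μ ν ≤ _
  rw [measDist, ← (measDist_summable μ ν).sum_add_tsum_nat_add N, distBound]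
  refine add_le_add (Finset.sum_le_sum fun i _ => mul_le_mul_of_nonneg_left
    (sub_le_sub_left (max_pow_le_exp_neg K) _) (by positivity)) ?_
  -- The neglected terms are dominated by a geometric series with sum 2 · 2⁻ᴺ.
  have hs : Summable fun i : ℕ => (2 : ℝ)⁻¹ ^ N * (2 : ℝ)⁻¹ ^ i :=
    (summable_geometric_of_lt_one (by norm_num) (by norm_num)).mul_left _
  refine (((summable_nat_add_iff N).2 (measDist_summable μ ν)).tsum_le_tsum (fun i => ?_) hs).trans
    ?_
  · rw [pow_add, mul_comm ((2 : ℝ)⁻¹ ^ i)]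
    refine mul_le_of_le_one_right (by positivity) ?_
    linarith [Real.exp_pos (-|_root_.basicIntegral (i + N) μ - _root_.basicIntegral (i + N) ν|)]
  · rw [tsum_mul_left, tsum_geometric_of_lt_one (by norm_num) (by norm_num)]
    norm_num [mul_comm]

/-- The bound converges to the distance when K and then N tends to infinity. Together with
`dist_le_distBound`, an open ball of measures is the union over N and K of the sets where
`distBound` is less than the radius. -/
theorem exists_distBound_lt {μ ν : FinMeas X} {r : ℝ} (h : dist μ ν < r) :
    ∃ N K, distBound N K μ ν < r := by
  have h1 : Tendsto (fun N : ℕ => ∑ i ∈ Finset.range N, (2 : ℝ)⁻¹ ^ i *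
      (1 - Real.exp (-|basicIntegral i μ - basicIntegral i ν|)) + 2 * (2 : ℝ)⁻¹ ^ N) atTop
      (𝓝 (measDist μ ν + 2 * 0)) :=
    (measDist_summable μ ν).hasSum.tendsto_sum_nat.add (tendsto_half_pow.const_mul 2)
  rw [mul_zero, add_zero] at h1
  obtain ⟨N, hN⟩ := (h1.eventually (gt_mem_nhds h)).exists
  have h2 : Tendsto (fun K : ℕ => distBound N K μ ν) atTop (𝓝 (∑ i ∈ Finset.range N, (2 : ℝ)⁻¹ ^ i *
      (1 - Real.exp (-|basicIntegral i μ - basicIntegral i ν|)) + 2 * (2 : ℝ)⁻¹ ^ N)) :=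
    (tendsto_finsetSum _ fun i _ => ((tendsto_max_pow _).const_sub 1).const_mul _).add_const _
  exact ⟨N, (h2.eventually (gt_mem_nhds hN)).exists⟩

theorem RealComputable.distBound : RealComputable fun (p : ℕ × ℕ × ℕ) (μ : FinMeas X) =>
    distBound p.2.1 p.2.2 (BasicPoints.basicPt p.1) μ := by
  have h1 := ((RealComputable.basicIntegral_basicPt (X := X) (Y := FinMeas X)).comp
    (f := fun p : (ℕ × ℕ × ℕ) × ℕ => (p.2, p.1.1)) (by fun_prop)).sub
    ((RealComputable.basicIntegral (X := X)).comp
      (f := fun p : (ℕ × ℕ × ℕ) × ℕ => p.2) (by fun_prop))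
  have h2 := (RealComputable.zero.max (RealComputable.one.sub (h1.abs.mul
    (((RealComputable.natCast (f := fun p : (ℕ × ℕ × ℕ) × ℕ => p.1.2.2) (by fun_prop)).add
      RealComputable.one).inv_of_pos fun a y => by positivity)))).pow_of_nonneg
    (n := fun p => p.1.2.2) (fun _ _ => le_max_left _ _) (by fun_prop)
  exact (((RealComputable.halfPow (f := fun p : (ℕ × ℕ × ℕ) × ℕ => p.2) (by fun_prop)).mul
    (RealComputable.one.sub h2)).sum (n := fun p => p.2.1) (by fun_prop)).add
    ((RealComputable.natCast (f := fun _ => 2) (by fun_prop)).mul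
      (RealComputable.halfPow (f := fun p : ℕ × ℕ × ℕ => p.2.1) (by fun_prop)))

end Measure

/-! ## Finite suprema of truncated functions -/

/-- The maximum of `0` and the numbers `min (r j) (b j)` with `j < n`. -/
def truncSup (r b : ℕ → ℝ) (n : ℕ) : ℝ :=
  Nat.rec 0 (fun j v => max v (min (r j) (b j))) n

theorem truncSup_zero (r b : ℕ → ℝ) : truncSup r b 0 = 0 := rfl

theorem truncSup_succ (r b : ℕ → ℝ) (n : ℕ) :
    truncSup r b (n + 1) = max (truncSup r b n) (min (r n) (b n)) := rfl

theorem lt_truncSup_iff {r b : ℕ → ℝ} {n : ℕ} {q : ℝ} :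
    q < truncSup r b n ↔ q < 0 ∨ ∃ j < n, q < min (r j) (b j) := by
  induction n with
  | zero => simp [truncSup_zero]
  | succ n ih =>
    simp only [truncSup_succ, lt_max_iff (a := q) (b := truncSup r b n), ih, or_assoc,
      Nat.lt_succ_iff_lt_or_eq, or_and_right, exists_or, exists_eq_left]

theorem truncSup_lt_iff {r b : ℕ → ℝ} {n : ℕ} {q : ℝ} :
    truncSup r b n < q ↔ 0 < q ∧ ∀ j < n, min (r j) (b j) < q := by
  induction n with
  | zero => simp [truncSup_zero]
  | succ n ih => simp only [truncSup_succ, max_lt_iff, ih, and_assoc, Nat.forall_lt_succ_right]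

theorem monotone_truncSup (r b : ℕ → ℝ) : Monotone (truncSup r b) :=
  monotone_nat_of_le_succ fun _ => le_max_left _ _

theorem truncSup_nonneg (r b : ℕ → ℝ) (n : ℕ) : 0 ≤ truncSup r b n :=
  monotone_truncSup r b n.zero_le

theorem truncSup_le_one {b : ℕ → ℝ} (hb : ∀ j, b j ≤ 1) (r : ℕ → ℝ) (n : ℕ) :
    truncSup r b n ≤ 1 := by
  induction n with
  | zero => exact zero_le_one
  | succ n ih => exact max_le ih ((min_le_right _ _).trans (hb n))

/-- Maxima and minima are monotone and commute with adding δ. The case δ = 0 is monotonicity in the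
heights. -/
theorem truncSup_le_add {r r' b : ℕ → ℝ} {n : ℕ} {δ : ℝ} (hδ : 0 ≤ δ)
    (h : ∀ j < n, r j ≤ r' j + δ) : truncSup r b n ≤ truncSup r' b n + δ := by
  induction n with
  | zero => simpa [truncSup_zero] using hδ
  | succ n ih =>
    rw [truncSup_succ, truncSup_succ, ← max_add_add_right]
    refine max_le_max (ih fun j hj => h j (hj.trans n.lt_succ_self)) ?_
    rw [← min_add_add_right]
    exact min_le_min (h n n.lt_succ_self) (le_add_of_nonneg_right hδ)

theorem continuous_truncSup {X : Type*} [TopologicalSpace X] (r : ℕ → ℝ) {b : ℕ → X → ℝ}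
    (hb : ∀ j, Continuous (b j)) (n : ℕ) : Continuous fun x => truncSup r (fun j => b j x) n := by
  induction n with
  | zero => exact continuous_const
  | succ n ih => exact ih.max (continuous_const.min (hb n))

theorem RealComputable.truncSup {r b : ℕ → Y → ℝ} (hr : RealComputable r)
    (hb : RealComputable b) :
    RealComputable fun n y => truncSup (fun j => r j y) (fun j => b j y) n := by
  have hm := hr.min hb
  constructor
  · refine ((SemiDec.codeReal_lt (f := fun p : ℕ × ℕ => p.2) (g := fun _ => natCode 0)
      (by fun_prop) (by fun_prop)).or
      ((SemiDec.of_bool (b := fun q : (ℕ × ℕ) × ℕ => Nat.ble (q.2 + 1) q.1.1) (by fun_prop)).and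
      (hm.lower_comp (f := fun q : (ℕ × ℕ) × ℕ => q.2) (q := fun q => q.1.2) (by fun_prop)
        (by fun_prop))).exists_code).of_iff fun p y => ?_
    simp [lt_truncSup_iff]
  · refine ((SemiDec.codeReal_lt (g := fun p : ℕ × ℕ => p.2) (f := fun _ => natCode 0)
      (by fun_prop) (by fun_prop)).and
      ((hm.upper_comp (f := fun q : (ℕ × ℕ) × ℕ => q.2) (q := fun q => q.1.2) (by fun_prop)
        (by fun_prop)).forall_lt (N := fun p => p.1) (by fun_prop))).of_iff fun p y => ?_
    simp [truncSup_lt_iff]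

/-! ### Numbers of truncated suprema in the enumeration -/

namespace BasicExpr

def supIndex (a b : ℕ) : ℕ := 4 * Nat.pair a b + 1 + 1

def infIndex (a b : ℕ) : ℕ := 4 * Nat.pair a b + 2 + 1

/-- This is the combination c · 1 + 0 · 1: the code 0 denotes the rational 0, and the expression
numbered 0 is the constant 1. -/
def constIndex (c : ℕ) : ℕ := 4 * Nat.pair (Nat.pair c 0) (Nat.pair 0 0) + 3 + 1

def bumpIndex (i r s : ℕ) : ℕ := 4 * Nat.pair i (Nat.pair r s) + 1

theorem ofNat_supIndex (a b : ℕ) : ofNat (supIndex a b) = .sup (ofNat a) (ofNat b) := by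
  have hd : (4 * Nat.pair a b + 1) / 4 = Nat.pair a b := by omega
  rw [supIndex, ofNat_succ_sup (by omega), hd, Nat.unpair_pair]

theorem ofNat_infIndex (a b : ℕ) : ofNat (infIndex a b) = .inf (ofNat a) (ofNat b) := by
  have hd : (4 * Nat.pair a b + 2) / 4 = Nat.pair a b := by omega
  rw [infIndex, ofNat_succ_inf (by omega), hd, Nat.unpair_pair]

theorem ofNat_bumpIndex (i r s : ℕ) : ofNat (bumpIndex i r s) = .bump i r s := by
  have hd : (4 * Nat.pair i (Nat.pair r s)) / 4 = Nat.pair i (Nat.pair r s) := by omega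
  rw [bumpIndex, ofNat_succ_bump (by omega), hd, Nat.unpair_pair, Nat.unpair_pair]

theorem eval_ofNat_constIndex {X : Type*} [PseudoMetricSpace X] [BasicPoints X] (c : ℕ) (x : X) :
    (ofNat (constIndex c)).eval x = codeReal c := by
  have hd : (4 * Nat.pair (Nat.pair c 0) (Nat.pair 0 0) + 3) / 4 =
    Nat.pair (Nat.pair c 0) (Nat.pair 0 0) := by omega
  have h0 : ratOfCode 0 = 0 := by simp [ratOfCode]
  rw [constIndex, ofNat_succ_comb (by omega), hd]
  simp [ofNat_zero, eval, h0, codeReal]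

/-- The number of the basic function `truncSup` formed with rational constants and the basic
functions numbered by `k`. -/
def truncSupIndex (k : ℕ → ℕ) (L : List ℕ) (n : ℕ) : ℕ :=
  Nat.rec (constIndex 0) (fun j v => supIndex v (infIndex (constIndex (L.getD j 0)) (k j))) n

theorem eval_truncSupIndex {X : Type*} [PseudoMetricSpace X] [BasicPoints X] (k : ℕ → ℕ)
    (L : List ℕ) (n : ℕ) (x : X) : (ofNat (truncSupIndex k L n)).eval x =
      truncSup (fun j => codeReal (L.getD j 0)) (fun j => (ofNat (k j)).eval x) n := by
  induction n with
  | zero =>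
    rw [truncSup_zero]
    refine (eval_ofNat_constIndex 0 x).trans ?_
    simp [codeReal, ratOfCode]
  | succ n ih =>
    rw [truncSup_succ, ← ih]
    change (ofNat (supIndex (truncSupIndex k L n) _)).eval x = _
    rw [ofNat_supIndex, ofNat_infIndex]
    simp only [eval, eval_ofNat_constIndex]

theorem computable_truncSupIndex {k : ℕ → ℕ} (hk : Computable k) {L : α → List ℕ} {n : α → ℕ}
    (hL : Computable L) (hn : Computable n) :
    Computable fun a => truncSupIndex k (L a) (n a) := by
  refine Computable.natRec hn (Computable.const _) (g := fun q : α × ℕ × ℕ => supIndex q.2.2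
    (infIndex (constIndex ((L q.1).getD q.2.1 0)) (k q.2.1))) ?_
  unfold supIndex infIndex constIndex
  fun_prop

end BasicExpr

/-! ### Integrals of truncated suprema -/

section Measure

variable {X : Type*} [ComputableMetricSpace X] [MeasurableSpace X] [BorelSpace X]

theorem integrable_truncSup (r : ℕ → ℝ) {b : ℕ → X → ℝ} (hb : ∀ j, Continuous (b j))
    (hb1 : ∀ j x, b j x ≤ 1) (n : ℕ) (ν : Measure X) [IsFiniteMeasure ν] :
    Integrable (fun x => truncSup r (fun j => b j x) n) ν :=
  Integrable.of_bound (continuous_truncSup r hb n).measurable.aestronglyMeasurable 1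
    (Eventually.of_forall fun x => by
      rw [Real.norm_eq_abs, abs_of_nonneg (truncSup_nonneg _ _ _)]
      exact truncSup_le_one (fun j => hb1 j x) _ _)

theorem integral_truncSup_le_add {r r' : ℕ → ℝ} {b : ℕ → X → ℝ} (hb : ∀ j, Continuous (b j))
    (hb1 : ∀ j x, b j x ≤ 1) {n : ℕ} {δ : ℝ} (hδ : 0 ≤ δ) (h : ∀ j < n, r j ≤ r' j + δ)
    (ν : Measure X) [IsFiniteMeasure ν] : ∫ x, truncSup r (fun j => b j x) n ∂ν ≤
      ∫ x, truncSup r' (fun j => b j x) n ∂ν + δ * ν.real Set.univ := by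
  have h1 := integrable_truncSup r hb hb1 n ν
  have h2 := integrable_truncSup r' hb hb1 n ν
  calc ∫ x, truncSup r (fun j => b j x) n ∂ν
      ≤ ∫ x, (truncSup r' (fun j => b j x) n + δ) ∂ν :=
        integral_mono h1 (h2.add (integrable_const δ)) fun x => truncSup_le_add hδ h
    _ = _ := by rw [integral_add h2 (integrable_const δ), integral_const, smul_eq_mul, mul_comm δ]

/-- Integrals of finite suprema of basic functions truncated at computable heights. -/
theorem RealComputable.integral_truncSup {r : ℕ → Z × FinMeas X → ℝ} (hr : RealComputable r)
    {k : ℕ → ℕ} (hk : Computable k) (hk1 : ∀ j (x : X), (BasicExpr.ofNat (k j)).eval x ≤ 1) :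
    RealComputable fun n (y : Z × FinMeas X) =>
      ∫ x, _root_.truncSup (fun j => r j y) (fun j => (BasicExpr.ofNat (k j)).eval x) n
        ∂y.2.toMeasure := by
  have hcont : ∀ j, Continuous fun x : X => (BasicExpr.ofNat (k j)).eval x :=
    fun j => BasicExpr.continuous_eval _
  have hcode : ∀ (L : List ℕ) n (μ : FinMeas X),
      _root_.basicIntegral (BasicExpr.truncSupIndex k L n) μ =
        ∫ x, _root_.truncSup (fun j => codeReal (L.getD j 0))
          (fun j => (BasicExpr.ofNat (k j)).eval x) n ∂μ.toMeasure := fun L n μ => by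
    simp only [_root_.basicIntegral, BasicExpr.eval_truncSupIndex]
  have hidx : Computable fun q : (ℕ × ℕ) × List ℕ => BasicExpr.truncSupIndex k q.2 q.1.1 :=
    BasicExpr.computable_truncSupIndex hk (by fun_prop) (by fun_prop)
  have hbi := (RealComputable.basicIntegral (X := X)).comp_snd (Z := Z)
  -- Moving the heights by at most δ changes the integral by at most δ times the total mass. Adding
  -- 1 to the mass covers the zero measure and makes the change strictly smaller than d.
  have hδ : ∀ {d : ℝ} (μ : FinMeas X), 0 < d → 0 < d / (μ.toMeasure.real Set.univ + 1) ∧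
      d / (μ.toMeasure.real Set.univ + 1) * μ.toMeasure.real Set.univ < d := by
    intro d μ hd
    have hm : 0 ≤ μ.toMeasure.real Set.univ := measureReal_nonneg
    refine ⟨by positivity, ?_⟩
    rw [div_mul_eq_mul_div, div_lt_iff₀ (by positivity)]
    nlinarith
  constructor
  -- By monotonicity and continuity in the heights, the integral exceeds a rational exactly when it
  -- already does so with some rational heights below the real ones; the integrand is then a basic
  -- function.
  · refine (((hr.lower_comp (f := fun q : ((ℕ × ℕ) × List ℕ) × ℕ => q.2)
      (q := fun q => q.1.2.getD q.2 0) (by fun_prop) (by fun_prop)).forall_lt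
      (N := fun q : (ℕ × ℕ) × List ℕ => q.1.1) (by fun_prop)).and (hbi.lower_comp
        hidx (q := fun q => q.1.2) (by fun_prop))).exists_code.of_iff fun p y => ?_
    simp only [hcode]
    constructor
    · intro h
      obtain ⟨hδ0, hδ1⟩ := hδ y.2 (sub_pos.2 h)
      obtain ⟨L, hL⟩ := exists_list_codeReal_between (fun j => sub_lt_self (r j y) hδ0) p.1
      refine ⟨L, fun j hj => (hL j hj).2, ?_⟩
      have := integral_truncSup_le_add hcont hk1 hδ0.le
        (fun j hj => (sub_lt_iff_lt_add.1 (hL j hj).1).le) y.2.toMeasure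
      linarith
    · rintro ⟨L, h1, h2⟩
      have := integral_truncSup_le_add hcont hk1 le_rfl
        (fun j hj => (h1 j hj).le.trans_eq (add_zero _).symm) y.2.toMeasure
      linarith
  · refine (((hr.upper_comp (f := fun q : ((ℕ × ℕ) × List ℕ) × ℕ => q.2)
      (q := fun q => q.1.2.getD q.2 0) (by fun_prop) (by fun_prop)).forall_lt
      (N := fun q : (ℕ × ℕ) × List ℕ => q.1.1) (by fun_prop)).and (hbi.upper_comp
        hidx (q := fun q => q.1.2) (by fun_prop))).exists_code.of_iff fun p y => ?_
    simp only [hcode]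
    constructor
    · intro h
      obtain ⟨hδ0, hδ1⟩ := hδ y.2 (sub_pos.2 h)
      obtain ⟨L, hL⟩ := exists_list_codeReal_between (fun j => lt_add_of_pos_right (r j y) hδ0) p.1
      refine ⟨L, fun j hj => (hL j hj).1, ?_⟩
      have := integral_truncSup_le_add hcont hk1 hδ0.le
        (fun j hj => (hL j hj).2.le) y.2.toMeasure
      linarith
    · rintro ⟨L, h1, h2⟩
      have := integral_truncSup_le_add hcont hk1 le_rfl
        (fun j hj => (h1 j hj).le.trans_eq (add_zero _).symm) y.2.toMeasure
      linarith

end Measure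

/-! ## A divergent series with convergent weights -/

section Series

variable {e ε : ℕ → ℝ}

theorem abelDini_nonneg (he : ∀ n, 0 < e n) (hanti : Antitone e) (n : ℕ) :
    0 ≤ e n * (e (n + 1))⁻¹ - 1 := by
  rw [sub_nonneg, ← div_eq_mul_inv, one_le_div (he _)]
  exact hanti n.le_succ

theorem abelDini_term_le (he : ∀ n, 0 < e n) (hanti : Antitone e) (hε : ∀ n, ε n ≤ e n) (n : ℕ) :
    (e n * (e (n + 1))⁻¹ - 1) * ε (n + 1) ≤ e n - e (n + 1) := by
  refine (mul_le_mul_of_nonneg_left (hε (n + 1)) (abelDini_nonneg he hanti n)).trans_eq ?_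
  have := (he (n + 1)).ne'
  field_simp

theorem abelDini_summable (he : ∀ n, 0 < e n) (hanti : Antitone e) (hε0 : ∀ n, 0 ≤ ε n)
    (hε : ∀ n, ε n ≤ e n) : Summable fun n => (e n * (e (n + 1))⁻¹ - 1) * ε (n + 1) := by
  refine summable_of_sum_range_le (c := e 0)
    (fun n => mul_nonneg (abelDini_nonneg he hanti n) (hε0 _)) fun n => ?_
  refine (Finset.sum_le_sum fun i _ => abelDini_term_le he hanti hε i).trans ?_
  rw [Finset.sum_range_sub']
  linarith [he n]

/-- The tail is dominated by the telescoping differences of e, so it is at most e N. This explicit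
remainder makes the integral of the test computable. -/
theorem abelDini_tsum_le (he : ∀ n, 0 < e n) (hanti : Antitone e) (hε0 : ∀ n, 0 ≤ ε n)
    (hε : ∀ n, ε n ≤ e n) (N : ℕ) : ∑' n, (e n * (e (n + 1))⁻¹ - 1) * ε (n + 1) ≤
      ∑ n ∈ Finset.range N, (e n * (e (n + 1))⁻¹ - 1) * ε (n + 1) + e N := by
  rw [← (abelDini_summable he hanti hε0 hε).sum_add_tsum_nat_add N]
  refine add_le_add le_rfl (Real.tsum_le_of_sum_range_le
    (fun n => mul_nonneg (abelDini_nonneg he hanti _) (hε0 _)) fun n => ?_)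
  have h := Finset.sum_range_sub' (fun i => e (i + N)) n
  rw [zero_add] at h
  calc _ ≤ ∑ i ∈ Finset.range n, (e (i + N) - e (i + 1 + N)) := Finset.sum_le_sum fun i _ => by
          have := abelDini_term_le he hanti hε (i + N)
          rwa [show i + 1 + N = i + N + 1 by ring]
    _ ≤ e N := by rw [h]; linarith [he (n + N)]

/-- The ratios telescope to e 0 / e N, and each ratio is at most the exponential of the ratio minus
1. A finite sum would thus keep e N away from 0. -/
theorem abelDini_not_summable (he : ∀ n, 0 < e n) (hanti : Antitone e)
    (hlim : Tendsto e atTop (𝓝 0)) : ¬ Summable fun n => e n * (e (n + 1))⁻¹ - 1 := by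
  intro hs
  have hprod : ∀ N, e 0 ≤ e N * Real.exp (∑ n ∈ Finset.range N, (e n * (e (n + 1))⁻¹ - 1)) := by
    intro N
    induction N with
    | zero => simp
    | succ N ih =>
      rw [Finset.sum_range_succ, Real.exp_add]
      have h1 := Real.add_one_le_exp (e N * (e (N + 1))⁻¹ - 1)
      rw [sub_add_cancel, ← div_eq_mul_inv, div_le_iff₀ (he _)] at h1
      have h2 := mul_le_mul_of_nonneg_right h1
        (Real.exp_pos (∑ n ∈ Finset.range N, (e n * (e (n + 1))⁻¹ - 1))).le
      rw [div_eq_mul_inv] at h2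
      linarith
  have hle : ∀ N, e 0 ≤ e N * Real.exp (∑' n, (e n * (e (n + 1))⁻¹ - 1)) := fun N =>
    (hprod N).trans (mul_le_mul_of_nonneg_left (Real.exp_le_exp.2
      (hs.sum_le_tsum _ fun n _ => abelDini_nonneg he hanti n)) (he N).le)
  have := ge_of_tendsto' (hlim.mul_const _) hle
  rw [zero_mul] at this
  exact this.not_gt (he 0)

end Series

/-! ## The Schnorr integral test obtained from a Kurtz test -/

section Test

set_option linter.unusedSectionVars false

variable {A X : Type*} [ComputableMetricSpace A] [ComputableMetricSpace X] [MeasurableSpace X]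
  [BorelSpace X]

/-- A function on `A × FinMeas X` that, as `s`, `N`, `K` vary, approximates the indicator of the
projection of the `n`-th ball from below; here `j` codes `(n, N, K, s)`. -/
def ballHeight (I : ℕ → Bool) (j : ℕ) (y : A × FinMeas X) : ℝ :=
  if I j.unpair.1 = true then
    max 0 (min 1 ((j.unpair.2.unpair.2.unpair.2 : ℝ) * ((posRat j.unpair.1.unpair.2 : ℝ) -
      max (dist (BasicPoints.basicPt j.unpair.1.unpair.1.unpair.1) y.1)
        (distBound j.unpair.2.unpair.1 j.unpair.2.unpair.2.unpair.1
          (BasicPoints.basicPt j.unpair.1.unpair.1.unpair.2.unpair.1) y.2))))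
  else 0

/-- The number of a bump function on `X` that vanishes outside of the projection of the `n`-th
ball, where `j` codes `(n, N, K, s)`, and that is `1` on a ball which is smaller by the factor
`(s + 1) / (s + 2)`. -/
def ballBumpIndex (j : ℕ) : ℕ :=
  let u := j.unpair.1.unpair.2.unpair.1
  let v := j.unpair.1.unpair.2.unpair.2
  let s := j.unpair.2.unpair.2.unpair.2
  BasicExpr.bumpIndex j.unpair.1.unpair.1.unpair.2.unpair.2
    -- With radius ρ = (u + 1)/(v + 1), these codes denote ρ(s + 1)/(s + 2) and ρ/(s + 2), whose sum
    -- is ρ: after adding 1 the entries are (u + 1)(s + 1), (v + 1)(s + 2) and u + 1.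
    (Nat.pair (u * s + u + s) (v * s + 2 * v + s + 1)) (Nat.pair u (v * s + 2 * v + s + 1))

theorem computable_ballBumpIndex : Computable ballBumpIndex := by
  unfold ballBumpIndex BasicExpr.bumpIndex
  dsimp only
  fun_prop

theorem eval_ballBumpIndex (j : ℕ) (x : X) : (BasicExpr.ofNat (ballBumpIndex j)).eval x =
    max 0 (min 1 (((posRat j.unpair.1.unpair.2 : ℝ) -
      dist (BasicPoints.basicPt j.unpair.1.unpair.1.unpair.2.unpair.2) x) *
      (((j.unpair.2.unpair.2.unpair.2 : ℝ) + 2) * (posRat j.unpair.1.unpair.2 : ℝ)⁻¹))) := by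
  rw [ballBumpIndex, BasicExpr.ofNat_bumpIndex, BasicExpr.eval, bumpFun]
  set u := j.unpair.1.unpair.2.unpair.1
  set v := j.unpair.1.unpair.2.unpair.2
  set s := j.unpair.2.unpair.2.unpair.2
  have hu : (0 : ℝ) < (u : ℝ) + 1 := by positivity
  have hv : (0 : ℝ) < (v : ℝ) + 1 := by positivity
  have hs : (0 : ℝ) < (s : ℝ) + 2 := by positivity
  have hq : (v : ℝ) * s + 2 * v + s + 1 + 1 = (v + 1) * (s + 2) := by ring
  have h1 : (posRat (Nat.pair u (v * s + 2 * v + s + 1)) : ℝ) =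
      posRat j.unpair.1.unpair.2 * ((s : ℝ) + 2)⁻¹ := by
    simp only [posRat, Nat.unpair_pair]
    push_cast
    rw [hq]
    change _ = ((u : ℝ) + 1) / (v + 1) * _
    field_simp
  have h2 : (posRat (Nat.pair (u * s + u + s) (v * s + 2 * v + s + 1)) : ℝ) +
      posRat (Nat.pair u (v * s + 2 * v + s + 1)) = posRat j.unpair.1.unpair.2 := by
    simp only [posRat, Nat.unpair_pair]
    push_cast
    rw [hq]
    change _ = ((u : ℝ) + 1) / (v + 1)
    field_simp
    ring
  rw [h2, ← h2, add_sub_cancel_left, h2, h1, div_eq_mul_inv, mul_inv, inv_inv, mul_comm ((s : ℝ) + 2)]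

theorem eval_ballBumpIndex_le_one (j : ℕ) (x : X) :
    (BasicExpr.ofNat (ballBumpIndex j)).eval x ≤ 1 := by
  rw [eval_ballBumpIndex]
  exact max_le zero_le_one (min_le_left _ _)

theorem RealComputable.ballHeight {I : ℕ → Bool} (hI : Computable I) :
    RealComputable fun j (y : A × FinMeas X) => ballHeight I j y := by
  refine RealComputable.ite (b := fun j : ℕ => I j.unpair.1) (by fun_prop) ?_ .zero
  exact RealComputable.zero.max (RealComputable.one.min ((RealComputable.natCast
    (f := fun j : ℕ => j.unpair.2.unpair.2.unpair.2) (by fun_prop)).mul ((RealComputable.posRat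
    (f := fun j : ℕ => j.unpair.1.unpair.2) (by fun_prop)).sub
    (((RealComputable.dist_basicPt (X := A)).comp_fst.comp
      (f := fun j : ℕ => j.unpair.1.unpair.1.unpair.1) (by fun_prop)).max
      ((RealComputable.distBound (X := X)).comp_snd.comp (f := fun j : ℕ =>
        (j.unpair.1.unpair.1.unpair.2.unpair.1, j.unpair.2.unpair.1,
          j.unpair.2.unpair.2.unpair.1)) (by fun_prop))))))

theorem RealComputable.eval_ballBumpIndex :
    RealComputable fun j (x : X) => (BasicExpr.ofNat (ballBumpIndex j)).eval x := by
  have h1 : RealComputable fun (j : ℕ) (x : X) => (_root_.posRat j.unpair.1.unpair.2 : ℝ) -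
      dist (BasicPoints.basicPt j.unpair.1.unpair.1.unpair.2.unpair.2) x :=
    (RealComputable.posRat (f := fun j : ℕ => j.unpair.1.unpair.2) (by fun_prop)).sub
      (RealComputable.dist_basicPt.comp (f := fun j : ℕ => j.unpair.1.unpair.1.unpair.2.unpair.2)
        (by fun_prop))
  have h2 : RealComputable fun (j : ℕ) (_ : X) =>
      ((j.unpair.2.unpair.2.unpair.2 + 2 : ℕ) : ℝ) :=
    RealComputable.natCast (f := fun j : ℕ => j.unpair.2.unpair.2.unpair.2 + 2) (by fun_prop)
  have h3 : RealComputable fun (j : ℕ) (_ : X) => (_root_.posRat j.unpair.1.unpair.2 : ℝ)⁻¹ :=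
    (RealComputable.posRat (f := fun j : ℕ => j.unpair.1.unpair.2) (by fun_prop)).inv_of_pos
      fun _ _ => posRat_pos _
  refine (RealComputable.zero.max (RealComputable.one.min (h1.mul (h2.mul h3)))).of_eq
    fun j x => ?_
  rw [_root_.eval_ballBumpIndex]
  push_cast
  rfl

/-- Approximations from below to the indicator of the union of the balls in `I`. -/
def openApprox (I : ℕ → Bool) (n : ℕ) (y : A × FinMeas X) (x : X) : ℝ :=
  truncSup (fun j => ballHeight I j y) (fun j => (BasicExpr.ofNat (ballBumpIndex j)).eval x) n

theorem openApprox_nonneg (I : ℕ → Bool) (n : ℕ) (y : A × FinMeas X) (x : X) :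
    0 ≤ openApprox I n y x := truncSup_nonneg _ _ _

theorem openApprox_le_one (I : ℕ → Bool) (n : ℕ) (y : A × FinMeas X) (x : X) :
    openApprox I n y x ≤ 1 := truncSup_le_one (fun j => eval_ballBumpIndex_le_one j x) _ _

theorem monotone_openApprox (I : ℕ → Bool) (y : A × FinMeas X) (x : X) :
    Monotone fun n => openApprox I n y x := monotone_truncSup _ _

theorem continuous_openApprox (I : ℕ → Bool) (n : ℕ) (y : A × FinMeas X) :
    Continuous (openApprox I n y) :=
  continuous_truncSup _ (fun _ => BasicExpr.continuous_eval _) n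

theorem integrable_openApprox (I : ℕ → Bool) (n : ℕ) (y : A × FinMeas X) :
    Integrable (openApprox I n y) y.2.toMeasure :=
  integrable_truncSup _ (fun _ => BasicExpr.continuous_eval _) eval_ballBumpIndex_le_one n _

theorem max_zero_min_one_eq_zero {u : ℝ} (h : u ≤ 0) : max 0 (min 1 u) = 0 :=
  max_eq_left ((min_le_right _ _).trans h)

theorem max_zero_min_one_eq_one {u : ℝ} (h : 1 ≤ u) : max 0 (min 1 u) = 1 := by
  rw [min_eq_left h, max_eq_right zero_le_one]

theorem mem_basicBall_prod {n : ℕ} {a : A} {μ : FinMeas X} {x : X} :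
    (a, μ, x) ∈ basicBall (A × FinMeas X × X) n ↔
      dist (BasicPoints.basicPt n.unpair.1.unpair.1) a < posRat n.unpair.2 ∧
      dist (BasicPoints.basicPt n.unpair.1.unpair.2.unpair.1) μ < posRat n.unpair.2 ∧
      dist (BasicPoints.basicPt n.unpair.1.unpair.2.unpair.2) x < posRat n.unpair.2 := by
  rw [basicBall, Metric.mem_ball, dist_comm, Prod.dist_eq, max_lt_iff, Prod.dist_eq, max_lt_iff]
  rfl

/-- A positive term would force all three coordinates to be within the radius of the centre of a
ball in `I`; for the measure this uses that `distBound` overestimates the distance. -/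
theorem openApprox_eq_zero {I : ℕ → Bool} {a : A} {μ : FinMeas X} {x : X}
    (h : ∀ n, I n = true → (a, μ, x) ∉ basicBall (A × FinMeas X × X) n) (n : ℕ) :
    openApprox I n (a, μ) x = 0 := by
  refine le_antisymm (not_lt.1 fun hlt => ?_) (openApprox_nonneg _ _ _ _)
  rcases lt_truncSup_iff.1 hlt with h0 | ⟨j, -, hj⟩
  · exact lt_irrefl _ h0
  obtain ⟨h1, h2⟩ := lt_min_iff.1 hj
  rw [ballHeight] at h1
  split_ifs at h1 with hI
  · refine h _ hI (mem_basicBall_prod.2 ?_)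
    have h3 : max (dist (BasicPoints.basicPt j.unpair.1.unpair.1.unpair.1) a)
        (distBound j.unpair.2.unpair.1 j.unpair.2.unpair.2.unpair.1
          (BasicPoints.basicPt j.unpair.1.unpair.1.unpair.2.unpair.1) μ) <
          (posRat j.unpair.1.unpair.2 : ℝ) := by
      by_contra! h3
      rw [max_zero_min_one_eq_zero
        (mul_nonpos_of_nonneg_of_nonpos (Nat.cast_nonneg _) (sub_nonpos.2 h3))] at h1
      exact lt_irrefl _ h1
    obtain ⟨h4, h5⟩ := max_lt_iff.1 h3
    refine ⟨h4, (dist_le_distBound _ _ _ _).trans_lt h5, ?_⟩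
    by_contra! h6
    rw [eval_ballBumpIndex, max_zero_min_one_eq_zero (mul_nonpos_of_nonpos_of_nonneg
      (sub_nonpos.2 h6) (mul_nonneg (by positivity) (inv_nonneg.2 (posRat_pos _).le)))] at h2
    exact lt_irrefl _ h2
  · exact lt_irrefl _ h1

theorem eventually_openApprox_eq_one {I : ℕ → Bool} {a : A} {μ : FinMeas X} {x : X} {n : ℕ}
    (hI : I n = true) (h : (a, μ, x) ∈ basicBall (A × FinMeas X × X) n) :
    ∀ᶠ k in atTop, openApprox I k (a, μ) x = 1 := by
  obtain ⟨h1, h2, h3⟩ := mem_basicBall_prod.1 h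
  obtain ⟨N, K, hNK⟩ := exists_distBound_lt h2
  have hρ := posRat_pos n.unpair.2
  set ρ : ℝ := (posRat n.unpair.2 : ℝ)
  have hd : 0 < ρ - max (dist (BasicPoints.basicPt n.unpair.1.unpair.1) a)
      (distBound N K (BasicPoints.basicPt n.unpair.1.unpair.2.unpair.1) μ) :=
    sub_pos.2 (max_lt h1 hNK)
  have hd' : 0 < (ρ - dist (BasicPoints.basicPt n.unpair.1.unpair.2.unpair.2) x) * ρ⁻¹ :=
    mul_pos (sub_pos.2 h3) (inv_pos.2 hρ)
  -- A single s is taken large enough to lift both the height and the bump to the value 1.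
  obtain ⟨s, hs⟩ := exists_nat_ge (max (ρ - max (dist (BasicPoints.basicPt n.unpair.1.unpair.1) a)
      (distBound N K (BasicPoints.basicPt n.unpair.1.unpair.2.unpair.1) μ))⁻¹
    ((ρ - dist (BasicPoints.basicPt n.unpair.1.unpair.2.unpair.2) x) * ρ⁻¹)⁻¹)
  set j := Nat.pair n (Nat.pair N (Nat.pair K s)) with hj
  have e1 : j.unpair.1 = n := by simp [hj]
  have e2 : j.unpair.2.unpair.1 = N := by simp [hj]
  have e3 : j.unpair.2.unpair.2.unpair.1 = K := by simp [hj]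
  have e4 : j.unpair.2.unpair.2.unpair.2 = s := by simp [hj]
  have hp : ballHeight I j (a, μ) = 1 := by
    rw [ballHeight, e1, e2, e3, e4, if_pos hI]
    exact max_zero_min_one_eq_one ((inv_le_iff_one_le_mul₀ hd).1 ((le_max_left _ _).trans hs))
  have hb : (BasicExpr.ofNat (ballBumpIndex j)).eval x = 1 := by
    rw [eval_ballBumpIndex, e1, e4]
    refine max_zero_min_one_eq_one ?_
    have h4 := (inv_le_iff_one_le_mul₀ hd').1 ((le_max_right _ _).trans hs)
    refine h4.trans ?_
    rw [mul_left_comm (ρ - _)]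
    exact mul_le_mul_of_nonneg_right (by linarith) hd'.le
  filter_upwards [eventually_gt_atTop j] with k hk
  refine le_antisymm (openApprox_le_one _ _ _ _) (not_lt.1 fun hlt => ?_)
  have := (truncSup_lt_iff.1 hlt).2 j hk
  rw [hp, hb, min_self] at this
  exact lt_irrefl _ this

/-- The integral of `1 - openApprox I n y`. -/
def deficit (I : ℕ → Bool) (n : ℕ) (y : A × FinMeas X) : ℝ :=
  ∫ x, (1 - openApprox I n y x) ∂y.2.toMeasure

theorem deficit_nonneg (I : ℕ → Bool) (n : ℕ) (y : A × FinMeas X) : 0 ≤ deficit I n y :=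
  integral_nonneg fun x => sub_nonneg.2 (openApprox_le_one I n y x)

theorem antitone_deficit (I : ℕ → Bool) (y : A × FinMeas X) :
    Antitone fun n => deficit I n y := fun n m hnm =>
  integral_mono ((integrable_const 1).sub (integrable_openApprox I m y))
    ((integrable_const 1).sub (integrable_openApprox I n y))
    fun x => sub_le_sub_left (monotone_openApprox I y x hnm) 1

theorem RealComputable.deficit {I : ℕ → Bool} (hI : Computable I) :
    RealComputable fun n (y : A × FinMeas X) => deficit I n y := by
  -- The basic function numbered 0 is the constant 1, so its integral is the total mass.
  refine (((RealComputable.basicIntegral (X := X)).comp_snd (Z := A)).comp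
    (f := fun _ : ℕ => 0) (by fun_prop)).sub (RealComputable.integral_truncSup
      (RealComputable.ballHeight (A := A) (X := X) hI) computable_ballBumpIndex
        eval_ballBumpIndex_le_one) |>.of_eq fun n y => ?_
  rw [_root_.deficit, integral_sub (integrable_const 1) (integrable_openApprox I n y)]
  simp only [_root_.basicIntegral, BasicExpr.ofNat_zero, BasicExpr.eval]
  rfl

/-- Dominated convergence: at almost every x the approximations are eventually equal to 1. -/
theorem tendsto_deficit {I : ℕ → Bool} {y : A × FinMeas X}
    (h : ∀ᵐ x ∂y.2.toMeasure, ∃ n, I n = true ∧ (y.1, y.2, x) ∈ basicBall (A × FinMeas X × X) n) :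
    Tendsto (fun n => deficit I n y) atTop (𝓝 0) := by
  have := tendsto_integral_of_dominated_convergence (μ := y.2.toMeasure)
    (F := fun n x => 1 - openApprox I n y x) (f := fun _ => 0) (fun _ => (1 : ℝ))
    (fun n => (continuous_const.sub (continuous_openApprox I n y)).measurable.aestronglyMeasurable)
    (integrable_const _)
    (fun n => Eventually.of_forall fun x => by
      rw [Real.norm_eq_abs, abs_of_nonneg (sub_nonneg.2 (openApprox_le_one I n y x))]
      linarith [openApprox_nonneg I n y x])
    (h.mono fun x ⟨n, hn, hx⟩ => tendsto_const_nhds.congr'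
      ((eventually_openApprox_eq_one hn hx).mono fun k hk => by
        change (0 : ℝ) = 1 - openApprox I k (y.1, y.2) x
        rw [hk, sub_self]))
  simpa [deficit] using this

/-- The integrals `deficit I n y`, made positive. -/
def posDeficit (I : ℕ → Bool) (n : ℕ) (y : A × FinMeas X) : ℝ := deficit I n y + (2 : ℝ)⁻¹ ^ n

theorem deficit_le_posDeficit (I : ℕ → Bool) (n : ℕ) (y : A × FinMeas X) :
    deficit I n y ≤ posDeficit I n y := le_add_of_nonneg_right (by positivity)

theorem posDeficit_pos (I : ℕ → Bool) (n : ℕ) (y : A × FinMeas X) : 0 < posDeficit I n y :=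
  add_pos_of_nonneg_of_pos (deficit_nonneg I n y) (by positivity)

theorem antitone_posDeficit (I : ℕ → Bool) (y : A × FinMeas X) :
    Antitone fun n => posDeficit I n y := fun _ _ hnm =>
  add_le_add (antitone_deficit I y hnm) (pow_le_pow_of_le_one (by norm_num) (by norm_num) hnm)

theorem RealComputable.posDeficit {I : ℕ → Bool} (hI : Computable I) :
    RealComputable fun n (y : A × FinMeas X) => posDeficit I n y :=
  (RealComputable.deficit hI).add (.halfPow (f := fun n => n) (by fun_prop))

/-- The weights of the Schnorr integral test. -/
def weight (I : ℕ → Bool) (n : ℕ) (y : A × FinMeas X) : ℝ :=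
  posDeficit I n y * (posDeficit I (n + 1) y)⁻¹ - 1

theorem weight_nonneg (I : ℕ → Bool) (n : ℕ) (y : A × FinMeas X) : 0 ≤ weight I n y :=
  abelDini_nonneg (fun n => posDeficit_pos I n y) (antitone_posDeficit I y) n

theorem summable_weight_mul_deficit (I : ℕ → Bool) (y : A × FinMeas X) :
    Summable fun n => weight I n y * deficit I (n + 1) y :=
  abelDini_summable (e := fun n => posDeficit I n y) (ε := fun n => deficit I n y)
    (fun n => posDeficit_pos I n y) (antitone_posDeficit I y)
    (fun n => deficit_nonneg I n y) fun n => deficit_le_posDeficit I n y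

theorem RealComputable.weight {I : ℕ → Bool} (hI : Computable I) :
    RealComputable fun n (y : A × FinMeas X) => weight I n y :=
  ((RealComputable.posDeficit hI).mul (((RealComputable.posDeficit hI).comp
    (f := fun n => n + 1) (by fun_prop)).inv_of_pos fun _ _ => posDeficit_pos _ _ _)).sub .one

def schnorrTerm (I : ℕ → Bool) (n : ℕ) (z : A × FinMeas X × X) : ℝ :=
  weight I n (z.1, z.2.1) * (1 - openApprox I (n + 1) (z.1, z.2.1) z.2.2)

theorem schnorrTerm_nonneg (I : ℕ → Bool) (n : ℕ) (z : A × FinMeas X × X) :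
    0 ≤ schnorrTerm I n z :=
  mul_nonneg (weight_nonneg _ _ _) (sub_nonneg.2 (openApprox_le_one _ _ _ _))

/-- Regrouping the entries lets weights and heights, which depend on the first two coordinates only,
be evaluated from names of triples. -/
theorem IsCauchyName.assoc_left {h : ℕ → ℕ} {z : A × FinMeas X × X} (hh : IsCauchyName h z) :
    IsCauchyName ((fun n => Nat.pair n.unpair.1 n.unpair.2.unpair.1) ∘ h) (z.1, z.2.1) := by
  have h1 := hh.fst
  have h2 := hh.snd.fst
  have hb : ∀ i, (BasicPoints.basicPt (((fun n => Nat.pair n.unpair.1 n.unpair.2.unpair.1) ∘ h) i) :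
      A × FinMeas X) = (BasicPoints.basicPt (h i).unpair.1,
        BasicPoints.basicPt (h i).unpair.2.unpair.1) := by
    intro i
    change (BasicPoints.basicPt (Nat.unpair (Nat.pair _ _)).1,
      BasicPoints.basicPt (Nat.unpair (Nat.pair _ _)).2) = _
    rw [Nat.unpair_pair]
  refine ⟨fun i j hij => ?_, ?_⟩
  · rw [hb, hb]
    exact max_le (h1.1 i j hij) (h2.1 i j hij)
  · simp only [hb]
    exact h1.2.prodMk_nhds h2.2

theorem RealComputable.schnorrTerm {I : ℕ → Bool} (hI : Computable I) :
    RealComputable fun n (z : A × FinMeas X × X) => schnorrTerm I n z := by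
  have hp : Primrec fun n : ℕ => Nat.pair n.unpair.1 n.unpair.2.unpair.1 :=
    Primrec₂.natPair.comp (Primrec.fst.comp Primrec.unpair) (Primrec.fst.comp
      (Primrec.unpair.comp (Primrec.snd.comp Primrec.unpair)))
  have h1 := (RealComputable.weight (A := A) (X := X) hI).comp_point hp
    (π := fun z : A × FinMeas X × X => (z.1, z.2.1)) fun _ _ h => h.assoc_left
  have h2 := (RealComputable.ballHeight (A := A) (X := X) hI).comp_point hp
    (π := fun z : A × FinMeas X × X => (z.1, z.2.1)) fun _ _ h => h.assoc_left
  exact h1.mul (RealComputable.one.sub ((h2.truncSup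
    (RealComputable.eval_ballBumpIndex (X := X)).comp_snd.comp_snd).comp (f := fun n => n + 1)
      (by fun_prop)))

/-- The Schnorr integral test for the union of the balls in `I`. -/
def schnorrTest (I : ℕ → Bool) (z : A × FinMeas X × X) : ENNReal :=
  ∑' n, ENNReal.ofReal (schnorrTerm I n z)

theorem schnorrTest_eq_iSup (I : ℕ → Bool) (z : A × FinMeas X × X) :
    ((schnorrTest I z : ENNReal) : EReal) =
      ⨆ N : ℕ, ((∑ n ∈ Finset.range N, schnorrTerm I n z : ℝ) : EReal) := by
  have hN : ∀ N : ℕ, ((∑ n ∈ Finset.range N, schnorrTerm I n z : ℝ) : EReal) =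
      ((∑ n ∈ Finset.range N, ENNReal.ofReal (schnorrTerm I n z) : ENNReal) : EReal) := by
    intro N
    rw [← ENNReal.ofReal_sum_of_nonneg fun n _ => schnorrTerm_nonneg I n z,
      EReal.coe_ennreal_ofReal, max_eq_left (Finset.sum_nonneg fun n _ => schnorrTerm_nonneg I n z)]
  simp only [hN]
  refine (iSup_eq_of_tendsto (fun N M h => ?_) ?_).symm
  · exact EReal.coe_ennreal_le_coe_ennreal_iff.2
      (Finset.sum_le_sum_of_subset (Finset.range_mono h))
  · exact (continuous_coe_ennreal_ereal.tendsto _).comp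
      (ENNReal.summable.hasSum.tendsto_sum_nat)

theorem lowerSemicomputable_schnorrTest {I : ℕ → Bool} (hI : Computable I) :
    LowerSemicomputable (schnorrTest I : A × FinMeas X × X → ENNReal) :=
  ⟨fun p => ∑ n ∈ Finset.range p.1, schnorrTerm I n p.2,
    RealComputable.computableMap_nat (F := fun N z => ∑ n ∈ Finset.range N, schnorrTerm I n z)
      (((RealComputable.schnorrTerm (A := A) (X := X) hI).comp (f := fun p : ℕ × ℕ => p.2)
        (by fun_prop)).sum (n := fun N : ℕ => N) (by fun_prop)),
    fun z => schnorrTest_eq_iSup I z⟩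

theorem lintegral_schnorrTest (I : ℕ → Bool) (a : A) (μ : FinMeas X) :
    ∫⁻ x, schnorrTest I (a, μ, x) ∂μ.toMeasure =
      ENNReal.ofReal (∑' n, weight I n (a, μ) * deficit I (n + 1) (a, μ)) := by
  have hc : ∀ n, Continuous fun x => schnorrTerm I n (a, μ, x) := fun n => by
    have := continuous_openApprox I (n + 1) (a, μ)
    change Continuous fun x => weight I n (a, μ) * (1 - openApprox I (n + 1) (a, μ) x)
    fun_prop
  rw [ENNReal.ofReal_tsum_of_nonneg
    (fun n => mul_nonneg (weight_nonneg _ _ _) (deficit_nonneg _ _ _))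
    (summable_weight_mul_deficit I (a, μ))]
  unfold schnorrTest
  rw [lintegral_tsum fun n => (hc n).measurable.ennreal_ofReal.aemeasurable]
  refine tsum_congr fun n => ?_
  have hint : Integrable (fun x => schnorrTerm I n (a, μ, x)) μ.toMeasure :=
    ((integrable_const 1).sub (integrable_openApprox I (n + 1) (a, μ))).const_mul
      (weight I n (a, μ))
  rw [← ofReal_integral_eq_lintegral_ofReal hint
    (Eventually.of_forall fun x => schnorrTerm_nonneg I n _)]
  congr 1
  exact integral_const_mul (weight I n (a, μ)) fun x => 1 - openApprox I (n + 1) (a, μ) x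

theorem isUniformSchnorrIntegralTest_schnorrTest {I : ℕ → Bool} (hI : Computable I)
    (h : ∀ (a : A) (μ : FinMeas X), ∀ᵐ x ∂μ.toMeasure,
      ∃ n, I n = true ∧ (a, μ, x) ∈ basicBall (A × FinMeas X × X) n) :
    IsUniformSchnorrIntegralTest (schnorrTest I : A × FinMeas X × X → ENNReal) where
  lowerSemicomputable := lowerSemicomputable_schnorrTest hI
  integral_lt_top a μ := by
    rw [lintegral_schnorrTest]
    exact ENNReal.ofReal_lt_top
  computable_integral := by
    have hval : ∀ y : A × FinMeas X, (∫⁻ x, schnorrTest I (y.1, y.2, x) ∂y.2.toMeasure).toReal =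
        ∑' n, weight I n y * deficit I (n + 1) y := fun y => by
      rw [lintegral_schnorrTest, ENNReal.toReal_ofReal]
      exact tsum_nonneg fun n => mul_nonneg (weight_nonneg _ _ _) (deficit_nonneg _ _ _)
    simp only [hval]
    refine RealComputable.computableMap ?_
    have hsum := summable_weight_mul_deficit (A := A) (X := X) I
    have hpart : RealComputable fun (p : Unit × ℕ) (y : A × FinMeas X) =>
        ∑ n ∈ Finset.range p.2, weight I n y * deficit I (n + 1) y :=
      ((((RealComputable.weight hI).mul ((RealComputable.deficit hI).comp (f := fun n => n + 1)
        (by fun_prop))).comp (f := fun q : (Unit × ℕ) × ℕ => q.2) (by fun_prop)).sum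
        (n := fun p : Unit × ℕ => p.2) (by fun_prop))
    have hlim : ∀ y : A × FinMeas X, Tendsto (fun n => posDeficit I n y) atTop (𝓝 0) := fun y => by
      simpa [posDeficit] using (tendsto_deficit (h y.1 y.2)).add tendsto_half_pow
    -- The partial sums approach the integral from below; adding `posDeficit` gives bounds from
    -- above with the same limit.
    refine RealComputable.of_tendsto hpart (hpart.add ((RealComputable.posDeficit hI).comp
      (f := fun p : Unit × ℕ => p.2) (by fun_prop))) (fun _ y k => ?_) (fun _ y k => ?_)
      (fun _ y => (hsum y).hasSum.tendsto_sum_nat) fun _ y => ?_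
    · exact (hsum y).sum_le_tsum _ fun n _ =>
        mul_nonneg (weight_nonneg _ _ _) (deficit_nonneg _ _ _)
    · exact abelDini_tsum_le (e := fun n => posDeficit I n y)
        (ε := fun n => deficit I n y) (fun n => posDeficit_pos I n y) (antitone_posDeficit I y)
        (fun n => deficit_nonneg I n y) (fun n => deficit_le_posDeficit I n y) k
    · simpa using (hsum y).hasSum.tendsto_sum_nat.add (hlim y)

/-- Outside the union each term is just the weight, and the weights have infinite sum because
`posDeficit` tends to 0. -/
theorem schnorrTest_eq_top {I : ℕ → Bool} {a : A} {μ : FinMeas X} {x : X}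
    (h : ∀ᵐ x ∂μ.toMeasure, ∃ n, I n = true ∧ (a, μ, x) ∈ basicBall (A × FinMeas X × X) n)
    (hx : ∀ n, I n = true → (a, μ, x) ∉ basicBall (A × FinMeas X × X) n) :
    schnorrTest I (a, μ, x) = ⊤ := by
  by_contra hne
  have hs := ENNReal.summable_toReal hne
  refine abelDini_not_summable (fun n => posDeficit_pos I n (a, μ)) (antitone_posDeficit I (a, μ))
    ?_ (hs.congr fun n => ?_)
  · simpa [posDeficit] using (tendsto_deficit (y := (a, μ)) h).add tendsto_half_pow
  · rw [ENNReal.toReal_ofReal (schnorrTerm_nonneg _ _ _), schnorrTerm, openApprox_eq_zero hx,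
      sub_zero, mul_one]
    rfl

end Test

end

theorem mainTheorem10 {A X : Type*} [ComputableMetricSpace A] [ComputableMetricSpace X]
    [MeasurableSpace X] [BorelSpace X] (a : A) (μ : FinMeas X) (x : X) (hx : x ∈ SR a μ) :
    x ∈ KR a μ := by
  intro P hP hxP
  obtain ⟨S, ⟨hdec, hS⟩, hPS⟩ := hP.effectivelyClosed
  have hmem : ∀ z, z ∉ P ↔ ∃ n, decide (n ∈ S) = true ∧ z ∈ basicBall (A × FinMeas X × X) n := by
    intro z
    rw [← Set.mem_compl_iff, hPS]
    simp
  -- All oracles and measures are needed here, since a uniform Schnorr test must have a computable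
  -- integral on the whole parameter space.
  have hae : ∀ (a : A) (μ : FinMeas X), ∀ᵐ x ∂μ.toMeasure,
      ∃ n, decide (n ∈ S) = true ∧ (a, μ, x) ∈ basicBall (A × FinMeas X × X) n := by
    intro a μ
    rw [ae_iff]
    simpa only [← hmem, not_not] using hP.measure_eq_zero a μ
  refine (hx _ (isUniformSchnorrIntegralTest_schnorrTest hS hae)).ne (schnorrTest_eq_top (hae a μ) ?_)
  intro n hn hn'
  exact (hmem _).2 ⟨n, hn, hn'⟩ hxP
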